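/- Let $n\ge 0$ be an integer and $\nu\in\mathbb{C}$. Let $\Gamma$ be a Hankel loop (it starts at $-\infty$, encircles the origin once in the positive direction and returns to $-\infty$), and for $t>0$ let $$w(z)=e^{\frac t2(z+\frac1z)+\nu\log z},\quad \arg z\in(-\pi,\pi),\qquad m_k(t)=\int_\Gamma s^k w(s)\frac{ds}{2\pi i s},\qquad D_{n,\nu}(t)=\det\big(m_{j-i}(t)\big)_{i,j=0}^{n-1}=\det\big(I_{i-j-\nu}(t)\big)_{i,j=0}^{n-1},$$ where $I_\mu(t)=\int_\Gamma e^{\frac t2(s+\frac1s)-\mu\log s}\frac{ds}{2\pi i s}$ is the modified Bessel function and $D_{0,\nu}=1$. Let $\pi_n$ be the monic polynomial of degree $n$ with $\int_\Gamma \pi_n(s)\,q(s^{-1})\,w(s)\frac{ds}{2\pi i s}=0$ for all polynomials $q$ of degree less than $n$ (it exists and is unique when $D_{n,\nu}(t)\neq0$), and put $$a_n\Big(\frac t2\Big)=-\frac{\pi_{n+1}(0)}{\pi_n(0)}.$$ Let $R$ be the set of all $x=t/2>0$ with $D_{n,\nu}(t)\ne0$, $D_{n+1,\nu}(t)\neq0$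 and $\pi_n(0)\ne0$, so that $a_n$ is well defined on $R$. (1) At every $x\in R$ with $a_n(x)\neq0$, the function $a_n$ is analytic and satisfies the Painlevé III equation $$a_n''=\frac{(a_n')^2}{a_n}-\frac{a_n'}{x}+\frac4x\big((\nu-n)a_n^2+n+\nu+1\big)+4a_n^3-\frac4{a_n}.$$ (2) There are an analytic function $\tau$ on $(0,\infty)$ that is, on $R$, a Jimbo–Miwa–Ueno isomonodromic $\tau$-function of Painlevé III for the solution $a_n$ with $\Theta_0=\nu-n$, $\Theta_\infty=-(n+\nu)$, and a constant $c\neq0$ such that $$D_{n,\nu}(t)=c\,e^{t^2/8}\,\tau(t/2)\qquad\text{for all }t>0.$$ Moreover, on every open interval $J\subseteq R$, every Jimbo–Miwa–Ueno $\tau$-function $\tau$ for $a_n$ with these parameters satisfies $D_{n,\nu}(t)=c\,e^{t^2/8}\tau(t/2)$ for all $t$ with $t/2\in J$, with a constant $c\neq0$. Here a Jimbo–Miwa–Ueno $\tau$-function, on an open set $U\subseteq(0,\infty)$, of Painlevé III for $y$ with parameters $\Theta_0,\Theta_\infty$ (the equation $y''=\frac{(y')^2}{y}-\frac{y'}{x}+\frac1x(4\Theta_0y^2+4(1-\Theta_\infty))+4y^3-\frac4y$)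 is defined as follows. With $\sigma_3=\mathrm{diag}(1,-1)$, take $2\times2$ matrix functions $$A=\tfrac{ix}{2}\sigma_3+\frac{A_{-1}(x)}{\lambda}+\frac{A_{-2}(x)}{\lambda^2},\qquad B=\tfrac{i\lambda}{2}\sigma_3+B_0(x)+\frac{B_{-1}(x)}{\lambda}$$ such that, for $x\in U$, $A_x-B_\lambda+[A,B]=0$ for all $\lambda\ne0$, $(A_{-2})_{12}\neq0$, $y=-i(A_{-1})_{12}/(A_{-2})_{12}$, and $\Phi_\lambda=A\Phi$ has formal solutions $\Phi=G_\infty e^{T_\infty}$ at $\lambda=\infty$ and $\Phi=G_0e^{T_0}$ at $\lambda=0$, where $G_\infty=I+O(\lambda^{-1})$ is a power series in $\lambda^{-1}$, $G_0$ is a power series in $\lambda$ with invertible constant term, and $$T_\infty=\Big(\tfrac{ix\lambda}{2}-\tfrac{\Theta_\infty}{2}\log\lambda\Big)\sigma_3,\qquad T_0=\Big(-\tfrac{ix}{2\lambda}+\tfrac{\Theta_0}{2}\log\lambda\Big)\sigma_3 .$$ Then $\tau$ is a nowhere vanishing function on $U$ with $$\frac{d}{dx}\log\tau=-\operatorname*{Res}_{\lambda=0}\operatorname{tr}\big(G_0^{-1}\,\partial_\lambda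 G_0\,\partial_xT_0\big)-\operatorname*{Res}_{\lambda=\infty}\operatorname{tr}\big(G_\infty^{-1}\,\partial_\lambda G_\infty\,\partial_xT_\infty\big).$$ -/

import Mathlib

open Complex MeasureTheory
open scoped PowerSeries

/-! ### The Hankel loop, the weight and the moments -/

/-- A Hankel loop: the parabola `s = (1 + i u)²`, `u ∈ ℝ`, with focus `0`. It comes from `-∞` below
the negative real axis, encircles the origin once in the positive direction, and returns to `-∞`
above the negative real axis; `arg s = 2 arctan u` runs through `(-π, π)`. -/
noncomputable def hankelLoop (u : ℝ) : ℂ := (1 + I * u) ^ 2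

/-- The contour integral `∫_Γ f(s) ds` along the Hankel loop. -/
noncomputable def loopIntegral (f : ℂ → ℂ) : ℂ :=
  ∫ u : ℝ, f (hankelLoop u) * deriv hankelLoop u

/-- The weight `w(z) = exp (t/2 (z + 1/z) + ν log z)`, with the principal branch of `log`. -/
noncomputable def weight (ν : ℂ) (t : ℝ) (z : ℂ) : ℂ :=
  Complex.exp ((t : ℂ) / 2 * (z + 1 / z) + ν * Complex.log z)

/-- The moments `m_k(t) = ∫_Γ s^k w(s) ds / (2πi s)`. -/
noncomputable def moment (ν : ℂ) (t : ℝ) (k : ℤ) : ℂ :=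
  loopIntegral fun s => s ^ k * weight ν t s / (2 * Real.pi * I * s)

/-- The Toeplitz determinant `D_{n,ν}(t) = det (m_{j-i}(t))_{i,j=0}^{n-1}`. -/
noncomputable def toeplitzDet (n : ℕ) (ν : ℂ) (t : ℝ) : ℂ :=
  Matrix.det (Matrix.of fun i j : Fin n => moment ν t ((j : ℤ) - (i : ℤ)))

/-- The modified Bessel function `I_μ(t)`, `t > 0`, of complex order, through its representation
`I_μ(t) = ∫_Γ exp (t/2 (s + 1/s) - μ log s) ds / (2πi s)` on the Hankel loop. -/
noncomputable def besselI (μ : ℂ) (t : ℝ) : ℂ :=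
  loopIntegral fun s => Complex.exp ((t : ℂ) / 2 * (s + 1 / s) - μ * Complex.log s) /
    (2 * Real.pi * I * s)

theorem hankelLoop_ne_zero (u : ℝ) : hankelLoop u ≠ 0 := by
  have h : (1 + I * u : ℂ) ≠ 0 := by
    intro h
    have := congrArg Complex.re h
    simp at this
  exact pow_ne_zero 2 h

/-- `m_k(t) = I_{-k-ν}(t)`. -/
theorem moment_eq_besselI (ν : ℂ) (t : ℝ) (k : ℤ) : moment ν t k = besselI (-(k : ℂ) - ν) t := by
  unfold moment besselI loopIntegral
  congr 1
  funext u
  have hs := hankelLoop_ne_zero u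
  have hk : hankelLoop u ^ k = Complex.exp ((k : ℂ) * Complex.log (hankelLoop u)) := by
    rw [Complex.exp_int_mul, Complex.exp_log hs]
  congr 2
  simp only [hk, weight, ← Complex.exp_add]
  congr 1
  congr 1
  ring

/-- `D_{n,ν}(t) = det (I_{i-j-ν}(t))_{i,j=0}^{n-1}`. -/
theorem toeplitzDet_eq_besselI (n : ℕ) (ν : ℂ) (t : ℝ) : toeplitzDet n ν t =
    Matrix.det (Matrix.of fun i j : Fin n => besselI (((i : ℕ) : ℂ) - ((j : ℕ) : ℂ) - ν) t) := by
  unfold toeplitzDet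
  congr 2
  funext i j
  rw [moment_eq_besselI]
  congr 1
  push_cast
  ring

/-! ### Orthogonal polynomials on the Hankel loop -/

/-- The pairing `⟨p, q⟩ = ∫_Γ p(s) q(1/s) w(s) ds / (2πi s)`. -/
noncomputable def loopPairing (ν : ℂ) (t : ℝ) (p q : Polynomial ℂ) : ℂ :=
  loopIntegral fun s => p.eval s * q.eval s⁻¹ * weight ν t s / (2 * Real.pi * I * s)

/-- `p` is a monic orthogonal polynomial of degree `n`: it is orthogonal, in the first argument of
the pairing, to all polynomials of degree less than `n`. -/
def IsMonicOP (n : ℕ) (ν : ℂ) (t : ℝ) (p : Polynomial ℂ) : Prop :=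
  p.Monic ∧ p.natDegree = n ∧ ∀ q : Polynomial ℂ, q.degree < n → loopPairing ν t p q = 0

open Classical in
/-- The monic orthogonal polynomial `π_n` (it exists and is unique when `D_{n,ν}(t) ≠ 0`). -/
noncomputable def monicOP (n : ℕ) (ν : ℂ) (t : ℝ) : Polynomial ℂ :=
  if h : ∃ p, IsMonicOP n ν t p then h.choose else 0

/-- The function `a_n`, given by `a_n(t/2) = -π_{n+1}(0) / π_n(0)`. -/
noncomputable def ratioA (n : ℕ) (ν : ℂ) (x : ℝ) : ℂ :=
  -((monicOP (n + 1) ν (2 * x)).eval 0 / (monicOP n ν (2 * x)).eval 0)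

/-- The points `x = t/2 > 0` at which `a_n(x)` is well defined: `π_n` and `π_{n+1}` are determined
by orthogonality, and `π_n(0) ≠ 0`. -/
def regularSet (n : ℕ) (ν : ℂ) : Set ℝ :=
  {x | 0 < x ∧ toeplitzDet n ν (2 * x) ≠ 0 ∧ toeplitzDet (n + 1) ν (2 * x) ≠ 0 ∧
    (monicOP n ν (2 * x)).eval 0 ≠ 0}

/-! ### The Lax pair of the third Painlevé equation and its isomonodromic τ-function -/

/-- The Pauli matrix `σ₃`. -/
def sigma3 : Matrix (Fin 2) (Fin 2) ℂ := !![1, 0; 0, -1]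

/-- The coefficient of `Φ_λ = A Φ`: `A(λ) = (i x / 2) σ₃ + A₁ / λ + A₂ / λ²`. -/
noncomputable def laxA (x : ℝ) (A₁ A₂ : Matrix (Fin 2) (Fin 2) ℂ) (l : ℂ) :
    Matrix (Fin 2) (Fin 2) ℂ :=
  (I * x / 2) • sigma3 + (1 / l) • A₁ + (1 / l ^ 2) • A₂

/-- The coefficient of `Φ_x = B Φ`: `B(λ) = (i λ / 2) σ₃ + B₀ + B₁ / λ`. -/
noncomputable def laxB (B₀ B₁ : Matrix (Fin 2) (Fin 2) ℂ) (l : ℂ) : Matrix (Fin 2) (Fin 2) ℂ :=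
  (I * l / 2) • sigma3 + B₀ + (1 / l) • B₁

/-- A matrix of numbers as a matrix of constant power series. -/
noncomputable def constMat (M : Matrix (Fin 2) (Fin 2) ℂ) : Matrix (Fin 2) (Fin 2) ℂ⟦X⟧ :=
  M.map PowerSeries.C

/-- The entrywise formal derivative. -/
noncomputable def derivMat (G : Matrix (Fin 2) (Fin 2) ℂ⟦X⟧) : Matrix (Fin 2) (Fin 2) ℂ⟦X⟧ :=
  G.map fun f => PowerSeries.derivative ℂ f

/-- `G(X)`, a power series in `X = 1/λ` with `G(0) = 1`, is the gauge factor of the formal solution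
`Φ = G(1/λ) exp T_∞(λ)` of `Φ_λ = A Φ` at `λ = ∞`, where
`T_∞(λ) = (i x λ / 2 - (Θ_∞ / 2) log λ) σ₃`. Since `∂_λ = -X² ∂_X`, the equation
`G_λ + G T_∞' = A G` reads as below. -/
def IsFormalAtInfinity (ΘI : ℂ) (x : ℝ) (A₁ A₂ : Matrix (Fin 2) (Fin 2) ℂ)
    (G : Matrix (Fin 2) (Fin 2) ℂ⟦X⟧) : Prop :=
  G.map PowerSeries.constantCoeff = 1 ∧
  -((PowerSeries.X ^ 2 : ℂ⟦X⟧) • derivMat G) +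
      G * (constMat ((I * x / 2) • sigma3) +
        (PowerSeries.X : ℂ⟦X⟧) • constMat (-(ΘI / 2) • sigma3)) =
    (constMat ((I * x / 2) • sigma3) + (PowerSeries.X : ℂ⟦X⟧) • constMat A₁ +
      (PowerSeries.X ^ 2 : ℂ⟦X⟧) • constMat A₂) * G

/-- `G(X)`, a power series in `X = λ` with `G(0)` invertible, is the gauge factor of the formal
solution `Φ = G(λ) exp T_0(λ)` of `Φ_λ = A Φ` at `λ = 0`, where
`T_0(λ) = (-i x / (2 λ) + (Θ_0 / 2) log λ) σ₃`. The equation `G_λ + G T_0' = A G`, multiplied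
by `λ²`, reads as below. -/
def IsFormalAtZero (Θ₀ : ℂ) (x : ℝ) (A₁ A₂ : Matrix (Fin 2) (Fin 2) ℂ)
    (G : Matrix (Fin 2) (Fin 2) ℂ⟦X⟧) : Prop :=
  IsUnit (G.map PowerSeries.constantCoeff) ∧
  (PowerSeries.X ^ 2 : ℂ⟦X⟧) • derivMat G +
      G * (constMat ((I * x / 2) • sigma3) +
        (PowerSeries.X : ℂ⟦X⟧) • constMat ((Θ₀ / 2) • sigma3)) =
    ((PowerSeries.X ^ 2 : ℂ⟦X⟧) • constMat ((I * x / 2) • sigma3) +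
      (PowerSeries.X : ℂ⟦X⟧) • constMat A₁ + constMat A₂) * G

/-- `-Res_{λ=0} tr (G⁻¹ G_λ ∂_x T_0)`, where `∂_x T_0 = -(i / (2 λ)) σ₃`: minus the coefficient of
`λ⁰` in `tr (G⁻¹ G_λ (-(i/2) σ₃))`. -/
noncomputable def jmuZero (G : Matrix (Fin 2) (Fin 2) ℂ⟦X⟧) : ℂ :=
  -PowerSeries.coeff 0 (Matrix.trace (G⁻¹ * derivMat G * constMat (-(I / 2) • sigma3)))

/-- `-Res_{λ=∞} tr (G⁻¹ G_λ ∂_x T_∞)`, where `∂_x T_∞ = (i λ / 2) σ₃`. As the residue at `∞` is minus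
the coefficient of `λ⁻¹ = X`, and `G_λ λ = -X G_X`, this is the coefficient of `X` in
`tr (G⁻¹ (-X G_X) ((i/2) σ₃))`. -/
noncomputable def jmuInfinity (G : Matrix (Fin 2) (Fin 2) ℂ⟦X⟧) : ℂ :=
  PowerSeries.coeff 1 (Matrix.trace
    (G⁻¹ * (-((PowerSeries.X : ℂ⟦X⟧) • derivMat G)) * constMat ((I / 2) • sigma3)))

/-- `A₁, A₂, B₀, B₁` form, on the set `U` of values of `x`, an isomonodromic Lax pair
`Φ_λ = A Φ`, `Φ_x = B Φ` belonging to the function `y`: the zero-curvature equation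
`A_x - B_λ + [A, B] = 0` holds and `y = -i (A₁)₁₂ / (A₂)₁₂`. -/
def IsLaxPair (y : ℝ → ℂ) (U : Set ℝ) (A₁ A₂ B₀ B₁ : ℝ → Matrix (Fin 2) (Fin 2) ℂ) : Prop :=
  (∀ x ∈ U, ∀ l : ℂ, l ≠ 0 → ∀ i j : Fin 2,
    HasDerivAt (fun x' => laxA x' (A₁ x') (A₂ x') l i j)
      (deriv (fun l' => laxB (B₀ x) (B₁ x) l' i j) l -
        (laxA x (A₁ x) (A₂ x) l * laxB (B₀ x) (B₁ x) l -
          laxB (B₀ x) (B₁ x) l * laxA x (A₁ x) (A₂ x) l) i j) x) ∧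
  ∀ x ∈ U, A₂ x 0 1 ≠ 0 ∧ y x = -I * (A₁ x 0 1 / A₂ x 0 1)

/-- `τ` is a Jimbo–Miwa–Ueno isomonodromic τ-function on `U` of the solution `y` of the third
Painlevé equation with parameters `(4 Θ_0, 4 (1 - Θ_∞), 4, -4)`: there is an isomonodromic Lax pair
belonging to `y`, with formal monodromy exponents `Θ_0` at `λ = 0` and `Θ_∞` at `λ = ∞`, such that
`τ` does not vanish on `U` and `d log τ / dx` is the sum of the residue terms at `0` and `∞`. -/
def IsJMUTau (Θ₀ ΘI : ℂ) (y : ℝ → ℂ) (U : Set ℝ) (τ : ℝ → ℂ) : Prop :=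
  ∃ A₁ A₂ B₀ B₁ : ℝ → Matrix (Fin 2) (Fin 2) ℂ, IsLaxPair y U A₁ A₂ B₀ B₁ ∧
    ∀ x ∈ U, τ x ≠ 0 ∧ ∃ G₀ GI : Matrix (Fin 2) (Fin 2) ℂ⟦X⟧,
      IsFormalAtZero Θ₀ x (A₁ x) (A₂ x) G₀ ∧ IsFormalAtInfinity ΘI x (A₁ x) (A₂ x) GI ∧
      HasDerivAt τ ((jmuZero G₀ + jmuInfinity GI) * τ x) x

/-! ### Gaussian decay on the Hankel parabola -/

open Filter Topology

/-! Write `x = t/2`. On the parabola the weight decays like a Gaussian, so the moments extend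
holomorphically to `Re x > 0`. They obey two rules: `m_k' = m_{k+1} + m_{k-1}` (differentiation
under the integral) and `(k+ν) m_k + x (m_{k+1} - m_{k-1}) = 0` (integration by parts). All
information on `D_n` and `π_n` comes from these.

Where `D_n` and `D_{n+1}` are nonzero, let `u`, `v` have as coefficients the last and first columns
of the inverse Toeplitz matrix of size `n+1`. Let `d, e, f` be its corner entries, and `κ, σ` the
first pairings of `u, v` outside the duality range. A polynomial of degree at most `n` is determined
by its `n+1` pairings, so the `x`-derivatives and the Euler derivatives `z∂_z` of `u, v` are
explicit combinations of `u`, `v`, `(u - (e/d)v)/z` and `z(v - (f/d)u)`. Comparing coefficients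
gives the constraint `νd = x(eσ - κf)` and the derivatives of `d, e, f, κ`. Since `π_n = u/d` and
`π_{n+1} = (zu - κv)/d`, one has `a_n = κd/e`. Together with `s = ef/d²` it forms a closed
first-order system (`hasDerivAt_ratioA`, `hasDerivAt_auxS`), and eliminating `s` gives Painlevé III.
The same relations evaluate `tr(T⁻¹T')`, hence the logarithmic derivative of `D_n` in terms of `x,
a_n, s` (`hasDerivAt_toeplitzDet`).

On the Lax side, the formal solutions at `0` and `∞` both evaluate the `λ⁻²` coefficient of `tr A²`.
This expresses the sum of the residues through `A` (`formal_relations`), and then through `x, y` and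
`p = (A₂)₁₁` alone (`mul_jmu_eq`). For existence, `p = -(ix/2)(1-2s)` turns the system for `(a_n,
s)` into a Lax pair (`isLaxPair_of_system`), whose residue sum is `D_n'/D_n - x`; the term `-x` is
the Gaussian factor. For uniqueness, zero curvature forces a Riccati equation for `y` with `p` as a
coefficient (`IsLaxPair.hasDerivAt`). Comparison with that of `a_n` determines `p`
(`lax_diagonal_eq`), so all τ-functions solve one linear first-order equation and are proportional
on intervals. -/

theorem hankelLoop_mem_slitPlane (u : ℝ) : hankelLoop u ∈ slitPlane := by
  rw [mem_slitPlane_iff]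
  by_cases hu : u = 0
  · left; simp [hankelLoop, hu]
  · right
    simp [hankelLoop, pow_two, hu]

theorem norm_hankelLoop (u : ℝ) : ‖hankelLoop u‖ = 1 + u ^ 2 := by
  rw [hankelLoop, norm_pow, ← normSq_eq_norm_sq]
  simp [normSq_apply]
  ring

theorem hankelLoop_re (u : ℝ) : (hankelLoop u).re = 1 - u ^ 2 := by
  simp [hankelLoop, pow_two]

theorem hankelLoop_im (u : ℝ) : (hankelLoop u).im = 2 * u := by
  simp [hankelLoop, pow_two]; ring

theorem hasDerivAt_hankelLoop (u : ℝ) : HasDerivAt hankelLoop (2 * I * (1 + I * u)) u := by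
  have h : HasDerivAt (fun u : ℝ => (1 + I * (u : ℂ))) I u := by
    simpa using ((hasDerivAt_id u).ofReal_comp.const_mul I).const_add 1
  have h2 := h.pow 2
  refine h2.congr_deriv ?_
  push_cast; ring

theorem one_add_I_mul_ne_zero (u : ℝ) : (1 + I * u : ℂ) ≠ 0 := by
  intro h
  simpa using congrArg Complex.re h

theorem one_add_sq_le_exp (u : ℝ) : 1 + u ^ 2 ≤ Real.exp (2 * |u|) := by
  have h : 1 + |u| ≤ Real.exp |u| := by linarith [Real.add_one_le_exp |u|]
  calc 1 + u ^ 2 ≤ (1 + |u|) ^ 2 := by rw [← sq_abs u]; nlinarith [abs_nonneg u]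
    _ ≤ Real.exp |u| ^ 2 := by gcongr
    _ = _ := by rw [← Real.exp_nat_mul]; norm_num

theorem norm_log_hankelLoop_le (u : ℝ) : ‖Complex.log (hankelLoop u)‖ ≤ 2 * |u| + Real.pi := by
  refine (Complex.norm_le_abs_re_add_abs_im _).trans ?_
  rw [Complex.log_re, Complex.log_im, norm_hankelLoop]
  refine add_le_add ?_ (Complex.abs_arg_le_pi _)
  have h1 : (1 : ℝ) ≤ 1 + u ^ 2 := by nlinarith
  rw [abs_of_nonneg (Real.log_nonneg h1), Real.log_le_iff_le_exp (by linarith)]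
  exact one_add_sq_le_exp u

/-- The term `Re z · (1 - u²)` of `Re (z s)` supplies the decay, `Im s = 2u` costs only a linear
term, and `|1/s| ≤ 1` costs a constant. -/
theorem norm_exp_mul_hankelLoop_le (z : ℂ) (u : ℝ) :
    ‖Complex.exp (z * (hankelLoop u + 1 / hankelLoop u))‖ ≤
      Real.exp (2 * ‖z‖ + 2 * ‖z‖ * |u| - z.re * u ^ 2) := by
  rw [Complex.norm_exp]
  refine Real.exp_le_exp.2 ?_
  have hd : (z * (1 / hankelLoop u)).re ≤ ‖z‖ := by
    refine (Complex.re_le_norm _).trans ?_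
    rw [norm_mul, norm_div, norm_one, norm_hankelLoop]
    refine mul_le_of_le_one_right (norm_nonneg z) ?_
    rw [div_le_one (by positivity)]
    nlinarith
  have hm : (z * hankelLoop u).re ≤ ‖z‖ + 2 * ‖z‖ * |u| - z.re * u ^ 2 := by
    rw [Complex.mul_re, hankelLoop_re, hankelLoop_im]
    have h1 := Complex.re_le_norm z
    have h2 : -(z.im * u) ≤ ‖z‖ * |u| := by
      calc -(z.im * u) ≤ |z.im * u| := neg_le_abs _
        _ = |z.im| * |u| := abs_mul _ _
        _ ≤ _ := by gcongr; exact Complex.abs_im_le_norm z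
    nlinarith
  rw [mul_add, Complex.add_re]
  linarith

/-- A continuous function on the line of at most exponential growth. -/
def ExpBounded (g : ℝ → ℂ) : Prop :=
  Continuous g ∧ ∃ C c : ℝ, 0 ≤ C ∧ ∀ u, ‖g u‖ ≤ C * Real.exp (c * |u|)

/-- Completing the square: half of the Gaussian rate absorbs the linear exponent. -/
theorem exp_mul_abs_sub_le {r : ℝ} (hr : 0 < r) (c u : ℝ) :
    Real.exp (c * |u| - r * u ^ 2) ≤ Real.exp (c ^ 2 / (2 * r)) * Real.exp (-(r / 2) * u ^ 2) := by
  rw [← Real.exp_add]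
  refine Real.exp_le_exp.2 ?_
  have h : c ^ 2 / (2 * r) - c * |u| + r / 2 * |u| ^ 2 = (c - r * |u|) ^ 2 / (2 * r) := by
    field_simp; ring
  have h2 : 0 ≤ (c - r * |u|) ^ 2 / (2 * r) := by positivity
  rw [← sq_abs u]
  linarith

theorem continuous_hankelLoop : Continuous hankelLoop := by
  unfold hankelLoop; fun_prop

theorem continuous_log_hankelLoop : Continuous fun u => Complex.log (hankelLoop u) :=
  continuous_hankelLoop.clog hankelLoop_mem_slitPlane

theorem continuous_exp_mul_hankelLoop (z : ℂ) :
    Continuous fun u => Complex.exp (z * (hankelLoop u + 1 / hankelLoop u)) := by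
  have := continuous_hankelLoop
  have h2 : Continuous fun u => 1 / hankelLoop u := continuous_const.div this hankelLoop_ne_zero
  fun_prop

/-- Uniformity in `z` is the point: it provides the dominating function for differentiation under
the integral. -/
theorem ExpBounded.gaussian_bound {g : ℝ → ℂ} (hg : ExpBounded g) {r R : ℝ} (hr : 0 < r) :
    ∃ C : ℝ, ∀ z : ℂ, r ≤ z.re → ‖z‖ ≤ R → ∀ u,
      ‖Complex.exp (z * (hankelLoop u + 1 / hankelLoop u)) * g u‖ ≤
        C * Real.exp (-(r / 2) * u ^ 2) := by
  obtain ⟨-, C, c, hC, hb⟩ := hg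
  refine ⟨C * Real.exp (2 * R) * Real.exp ((2 * R + c) ^ 2 / (2 * r)), fun z hz hR u => ?_⟩
  rw [norm_mul]
  calc _ ≤ Real.exp (2 * ‖z‖ + 2 * ‖z‖ * |u| - z.re * u ^ 2) * (C * Real.exp (c * |u|)) := by
        gcongr
        · exact norm_exp_mul_hankelLoop_le z u
        · exact hb u
    _ ≤ Real.exp (2 * R + 2 * R * |u| - r * u ^ 2) * (C * Real.exp (c * |u|)) := by gcongr
    _ = C * Real.exp (2 * R) * Real.exp ((2 * R + c) * |u| - r * u ^ 2) := by
        rw [mul_left_comm, mul_assoc C, ← Real.exp_add, ← Real.exp_add]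
        congr 2; ring
    _ ≤ C * Real.exp (2 * R) * (Real.exp ((2 * R + c) ^ 2 / (2 * r)) *
          Real.exp (-(r / 2) * u ^ 2)) := by
        gcongr; exact exp_mul_abs_sub_le hr _ _
    _ = _ := by ring

theorem ExpBounded.integrable {g : ℝ → ℂ} (hg : ExpBounded g) {z : ℂ} (hz : 0 < z.re) :
    Integrable fun u => Complex.exp (z * (hankelLoop u + 1 / hankelLoop u)) * g u := by
  obtain ⟨C, hC⟩ := hg.gaussian_bound (r := z.re) (R := ‖z‖) hz
  exact ((integrable_exp_neg_mul_sq (half_pos hz)).const_mul C).mono'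
    ((continuous_exp_mul_hankelLoop z).mul hg.1).aestronglyMeasurable
    (Eventually.of_forall fun u => hC z le_rfl le_rfl u)

theorem ExpBounded.tendsto_cocompact {g : ℝ → ℂ} (hg : ExpBounded g) {z : ℂ} (hz : 0 < z.re) :
    Tendsto (fun u => Complex.exp (z * (hankelLoop u + 1 / hankelLoop u)) * g u)
      (cocompact ℝ) (𝓝 0) := by
  obtain ⟨C, hC⟩ := hg.gaussian_bound (r := z.re) (R := ‖z‖) hz
  refine squeeze_zero_norm (fun u => hC z le_rfl le_rfl u) ?_
  rw [← mul_zero C]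
  refine Tendsto.const_mul C ?_
  have h := tendsto_rpow_abs_mul_exp_neg_mul_sq_cocompact (half_pos hz) 0
  simpa using h

theorem ExpBounded.mul {g h : ℝ → ℂ} (hg : ExpBounded g) (hh : ExpBounded h) :
    ExpBounded fun u => g u * h u := by
  obtain ⟨hg, C, c, hC, hb⟩ := hg
  obtain ⟨hh, C', c', hC', hb'⟩ := hh
  refine ⟨hg.mul hh, C * C', c + c', by positivity, fun u => ?_⟩
  calc _ ≤ (C * Real.exp (c * |u|)) * (C' * Real.exp (c' * |u|)) := by
        rw [norm_mul]; gcongr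
        · exact hb u
        · exact hb' u
    _ = _ := by rw [add_mul, Real.exp_add]; ring

theorem expBounded_exp_log (μ : ℂ) :
    ExpBounded fun u => Complex.exp (μ * Complex.log (hankelLoop u)) := by
  refine ⟨(continuous_const.mul continuous_log_hankelLoop).cexp,
    Real.exp (‖μ‖ * Real.pi), 2 * ‖μ‖, by positivity, fun u => ?_⟩
  rw [Complex.norm_exp, ← Real.exp_add]
  refine Real.exp_le_exp.2 ((Complex.re_le_norm _).trans ?_)
  rw [norm_mul]
  nlinarith [mul_le_mul_of_nonneg_left (norm_log_hankelLoop_le u) (norm_nonneg μ)]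

theorem expBounded_inv_one_add_I_mul : ExpBounded fun u : ℝ => (1 + I * u : ℂ)⁻¹ := by
  refine ⟨Continuous.inv₀ (by fun_prop) one_add_I_mul_ne_zero, 1, 0, zero_le_one, fun u => ?_⟩
  rw [norm_inv, zero_mul, Real.exp_zero, one_mul]
  refine inv_le_one_of_one_le₀ ?_
  simpa using Complex.re_le_norm (1 + I * u : ℂ)

theorem expBounded_const (a : ℂ) : ExpBounded fun _ : ℝ => a :=
  ⟨continuous_const, ‖a‖, 0, norm_nonneg a, fun u => by simp⟩

theorem hankelLoop_eq_exp_log (u : ℝ) :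
    hankelLoop u = Complex.exp (1 * Complex.log (hankelLoop u)) := by
  rw [one_mul, Complex.exp_log (hankelLoop_ne_zero u)]

theorem inv_hankelLoop_eq_exp_log (u : ℝ) :
    1 / hankelLoop u = Complex.exp (-1 * Complex.log (hankelLoop u)) := by
  rw [neg_one_mul, Complex.exp_neg, Complex.exp_log (hankelLoop_ne_zero u), one_div]

theorem expBounded_hankelLoop_add_inv :
    ExpBounded fun u => hankelLoop u + 1 / hankelLoop u := by
  obtain ⟨h1, C, c, hC, hb⟩ := expBounded_exp_log 1
  obtain ⟨h2, C', c', hC', hb'⟩ := expBounded_exp_log (-1)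
  simp_rw [← hankelLoop_eq_exp_log] at h1 hb
  simp_rw [← inv_hankelLoop_eq_exp_log] at h2 hb'
  refine ⟨h1.add h2, C + C', max c c', by positivity, fun u => ?_⟩
  calc _ ≤ C * Real.exp (c * |u|) + C' * Real.exp (c' * |u|) :=
        (norm_add_le _ _).trans (add_le_add (hb u) (hb' u))
    _ ≤ C * Real.exp (max c c' * |u|) + C' * Real.exp (max c c' * |u|) := by
        gcongr
        · exact le_max_left _ _
        · exact le_max_right _ _
    _ = _ := by ring

theorem ExpBounded.hasDerivAt_integral {g : ℝ → ℂ} (hg : ExpBounded g) {z : ℂ} (hz : 0 < z.re) :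
    HasDerivAt (fun z => ∫ u, Complex.exp (z * (hankelLoop u + 1 / hankelLoop u)) * g u)
      (∫ u, Complex.exp (z * (hankelLoop u + 1 / hankelLoop u)) *
        ((hankelLoop u + 1 / hankelLoop u) * g u)) z := by
  have hg' := expBounded_hankelLoop_add_inv.mul hg
  obtain ⟨C, hC⟩ := hg'.gaussian_bound (r := z.re / 2) (R := ‖z‖ + z.re / 2) (half_pos hz)
  refine (hasDerivAt_integral_of_dominated_loc_of_deriv_le (𝕜 := ℂ)
    (F := fun z u => Complex.exp (z * (hankelLoop u + 1 / hankelLoop u)) * g u)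
    (F' := fun z u => Complex.exp (z * (hankelLoop u + 1 / hankelLoop u)) *
        ((hankelLoop u + 1 / hankelLoop u) * g u))
    -- Radius `Re z / 2` keeps the real part at least `Re z / 2` throughout the ball.
    (s := Metric.ball z (z.re / 2)) (bound := fun u => C * Real.exp (-(z.re / 2 / 2) * u ^ 2))
    (Metric.ball_mem_nhds z (half_pos hz)) ?_ (hg.integrable hz) ?_ ?_ ?_ ?_).2
  · exact Eventually.of_forall fun w =>
      ((continuous_exp_mul_hankelLoop w).mul hg.1).aestronglyMeasurable
  · exact ((continuous_exp_mul_hankelLoop z).mul hg'.1).aestronglyMeasurable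
  · refine Eventually.of_forall fun u w hw => hC w ?_ ?_ u
    · have h := (abs_le.1 ((Complex.abs_re_le_norm (w - z)).trans
        (mem_ball_iff_norm.1 hw).le)).1
      rw [Complex.sub_re] at h
      linarith
    · have h := norm_add_le z (w - z)
      rw [add_sub_cancel] at h
      linarith [mem_ball_iff_norm.1 hw]
  · exact (integrable_exp_neg_mul_sq (half_pos (half_pos hz))).const_mul C
  · refine Eventually.of_forall fun u w _ => ?_
    have h := (((hasDerivAt_id w).mul_const (hankelLoop u + 1 / hankelLoop u)).cexp).mul_const (g u)
    refine h.congr_deriv ?_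
    simp only [id, one_mul]; ring

/-! ### Moments: analyticity, time derivative and recurrence -/

/-- The factor of the moment integrand that does not depend on the spectral time. -/
noncomputable def loopKernel (μ : ℂ) (u : ℝ) : ℂ :=
  Complex.exp (μ * Complex.log (hankelLoop u)) * (Real.pi * (1 + I * u) : ℂ)⁻¹

theorem expBounded_loopKernel (μ : ℂ) : ExpBounded (loopKernel μ) := by
  have h := ((expBounded_exp_log μ).mul expBounded_inv_one_add_I_mul).mul
    (expBounded_const (Real.pi : ℂ)⁻¹)
  refine (funext fun u => ?_ : _ = loopKernel μ) ▸ h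
  simp only [loopKernel, mul_inv]; ring

theorem hankelLoop_mul_loopKernel (μ : ℂ) (u : ℝ) :
    hankelLoop u * loopKernel μ u = loopKernel (μ + 1) u := by
  conv_lhs => rw [hankelLoop_eq_exp_log]
  rw [loopKernel, loopKernel, add_mul, Complex.exp_add]; ring

theorem inv_hankelLoop_mul_loopKernel (μ : ℂ) (u : ℝ) :
    1 / hankelLoop u * loopKernel μ u = loopKernel (μ - 1) u := by
  rw [inv_hankelLoop_eq_exp_log, loopKernel, loopKernel, sub_eq_add_neg, add_mul, Complex.exp_add]
  ring

/-- The integral `∫_Γ exp (z (s + 1/s) + μ log s) ds / (2πi s)` with complex time `z`. -/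
noncomputable def loopMoment (μ z : ℂ) : ℂ :=
  ∫ u, Complex.exp (z * (hankelLoop u + 1 / hankelLoop u)) * loopKernel μ u

/-- Differentiation brings down `s + 1/s`, and each summand shifts the power of `s` by one. -/
theorem hasDerivAt_loopMoment (μ : ℂ) {z : ℂ} (hz : 0 < z.re) :
    HasDerivAt (loopMoment μ) (loopMoment (μ + 1) z + loopMoment (μ - 1) z) z := by
  refine ((expBounded_loopKernel μ).hasDerivAt_integral hz).congr_deriv ?_
  rw [loopMoment, loopMoment, ← integral_add ((expBounded_loopKernel _).integrable hz)
    ((expBounded_loopKernel _).integrable hz)]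
  refine integral_congr_ae (Eventually.of_forall fun u => ?_)
  simp only [← hankelLoop_mul_loopKernel, ← inv_hankelLoop_mul_loopKernel]
  ring

/-- Integrate the total derivative of `exp (z (s + 1/s)) s^μ` along the loop; the boundary values
vanish at both ends. -/
theorem loopMoment_recurrence (μ : ℂ) {z : ℂ} (hz : 0 < z.re) :
    μ * loopMoment μ z + z * (loopMoment (μ + 1) z - loopMoment (μ - 1) z) = 0 := by
  have hint : ∀ μ, Integrable fun u =>
      Complex.exp (z * (hankelLoop u + 1 / hankelLoop u)) * loopKernel μ u :=
    fun μ => (expBounded_loopKernel μ).integrable hz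
  have hsub : Integrable fun u =>
      z * (Complex.exp (z * (hankelLoop u + 1 / hankelLoop u)) * loopKernel (μ + 1) u -
        Complex.exp (z * (hankelLoop u + 1 / hankelLoop u)) * loopKernel (μ - 1) u) :=
    ((hint _).sub (hint _)).const_mul z
  have hsum : Integrable fun u =>
      μ * (Complex.exp (z * (hankelLoop u + 1 / hankelLoop u)) * loopKernel μ u) +
      z * (Complex.exp (z * (hankelLoop u + 1 / hankelLoop u)) * loopKernel (μ + 1) u -
        Complex.exp (z * (hankelLoop u + 1 / hankelLoop u)) * loopKernel (μ - 1) u) :=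
    ((hint μ).const_mul μ).add hsub
  have hF : ∀ u : ℝ, HasDerivAt (fun u =>
      Complex.exp (z * (hankelLoop u + 1 / hankelLoop u)) *
        Complex.exp (μ * Complex.log (hankelLoop u)))
      (2 * Real.pi * I * (μ * (Complex.exp (z * (hankelLoop u + 1 / hankelLoop u)) *
        loopKernel μ u) +
      z * (Complex.exp (z * (hankelLoop u + 1 / hankelLoop u)) * loopKernel (μ + 1) u -
        Complex.exp (z * (hankelLoop u + 1 / hankelLoop u)) * loopKernel (μ - 1) u))) u := by
    intro u
    have hs := hasDerivAt_hankelLoop u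
    have hs0 := hankelLoop_ne_zero u
    have h1 : HasDerivAt (fun u => 1 / hankelLoop u)
        (-(2 * I * (1 + I * u)) / hankelLoop u ^ 2) u := by
      simpa only [one_div] using hs.fun_inv hs0
    have h := (((hs.add h1).const_mul z).cexp).mul
      (((hs.clog_real (hankelLoop_mem_slitPlane u)).const_mul μ).cexp)
    refine h.congr_deriv ?_
    have h0 := one_add_I_mul_ne_zero u
    have hpi : (Real.pi : ℂ) ≠ 0 := by exact_mod_cast Real.pi_ne_zero
    simp only [← hankelLoop_mul_loopKernel, ← inv_hankelLoop_mul_loopKernel, Pi.add_apply]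
    rw [loopKernel]
    have hsq : hankelLoop u = (1 + I * u) ^ 2 := rfl
    generalize Complex.exp (z * (hankelLoop u + 1 / hankelLoop u)) = E1
    generalize Complex.exp (μ * Complex.log (hankelLoop u)) = E2
    rw [hsq]
    field_simp
    ring
  have hG := (expBounded_exp_log μ).tendsto_cocompact hz
  rw [cocompact_eq_atBot_atTop] at hG
  have key := integral_of_hasDerivAt_of_tendsto hF (hsum.const_mul _)
    (hG.mono_left le_sup_left) (hG.mono_left le_sup_right)
  rw [integral_const_mul, integral_add ((hint μ).const_mul μ) hsub, integral_const_mul,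
    integral_const_mul, integral_sub (hint _) (hint _), sub_zero] at key
  exact (mul_eq_zero.1 key).resolve_left (by simp [Real.pi_ne_zero])

/-- On the parabola `ds / (2πi s) = du / (π (1 + i u))`, and `s^k` merges with the principal branch
of `s^ν`. -/
theorem weight_div_mul_deriv_hankelLoop (ν : ℂ) (x : ℝ) (k : ℤ) (u : ℝ) :
    hankelLoop u ^ k * weight ν (2 * x) (hankelLoop u) / (2 * Real.pi * I * hankelLoop u) *
      deriv hankelLoop u =
    Complex.exp (x * (hankelLoop u + 1 / hankelLoop u)) * loopKernel (k + ν) u := by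
  have hs := hankelLoop_ne_zero u
  have hk : hankelLoop u ^ k = Complex.exp ((k : ℂ) * Complex.log (hankelLoop u)) := by
    rw [Complex.exp_int_mul, Complex.exp_log hs]
  have hw : weight ν (2 * x) (hankelLoop u) =
      Complex.exp (x * (hankelLoop u + 1 / hankelLoop u)) *
        Complex.exp (ν * Complex.log (hankelLoop u)) := by
    rw [weight, ← Complex.exp_add]
    push_cast
    congr 1; ring
  rw [hk, hw, (hasDerivAt_hankelLoop u).deriv, loopKernel, add_mul, Complex.exp_add]
  have h0 := one_add_I_mul_ne_zero u
  have hpi : (Real.pi : ℂ) ≠ 0 := by exact_mod_cast Real.pi_ne_zero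
  generalize Complex.exp (x * (hankelLoop u + 1 / hankelLoop u)) = E1
  generalize Complex.exp (ν * Complex.log (hankelLoop u)) = E2
  generalize Complex.exp (k * Complex.log (hankelLoop u)) = E3
  have hsq : hankelLoop u = (1 + I * u) ^ 2 := rfl
  rw [hsq]
  field_simp

theorem moment_eq_loopMoment (ν : ℂ) (x : ℝ) (k : ℤ) :
    moment ν (2 * x) k = loopMoment (k + ν) x := by
  unfold moment loopIntegral loopMoment
  refine integral_congr_ae (Eventually.of_forall fun u => ?_)
  exact weight_div_mul_deriv_hankelLoop ν x k u

theorem analyticAt_moment (ν : ℂ) (k : ℤ) {x : ℝ} (hx : 0 < x) :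
    AnalyticAt ℝ (fun x : ℝ => moment ν (2 * x) k) x := by
  simp_rw [moment_eq_loopMoment]
  have hopen : IsOpen {z : ℂ | 0 < z.re} := isOpen_lt continuous_const Complex.continuous_re
  have hd : DifferentiableOn ℂ (loopMoment (k + ν)) {z : ℂ | 0 < z.re} :=
    fun z hz => (hasDerivAt_loopMoment _ hz).differentiableAt.differentiableWithinAt
  have h : AnalyticAt ℝ (loopMoment (k + ν)) (x : ℂ) :=
    (hd.analyticAt (hopen.mem_nhds (by simpa using hx))).restrictScalars
  exact h.comp (Complex.ofRealCLM.analyticAt x)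

theorem hasDerivAt_moment (ν : ℂ) (k : ℤ) {x : ℝ} (hx : 0 < x) :
    HasDerivAt (fun x : ℝ => moment ν (2 * x) k)
      (moment ν (2 * x) (k + 1) + moment ν (2 * x) (k - 1)) x := by
  simp_rw [moment_eq_loopMoment]
  refine (hasDerivAt_loopMoment (k + ν) (z := (x : ℂ))
    (by simpa using hx)).comp_ofReal.congr_deriv ?_
  push_cast
  congr 2 <;> ring

theorem moment_recurrence (ν : ℂ) (k : ℤ) {x : ℝ} (hx : 0 < x) :
    (k + ν) * moment ν (2 * x) k +
      x * (moment ν (2 * x) (k + 1) - moment ν (2 * x) (k - 1)) = 0 := by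
  simp_rw [moment_eq_loopMoment]
  rw [← loopMoment_recurrence (k + ν) (z := (x : ℂ)) (by simpa using hx)]
  push_cast
  congr 4 <;> ring

theorem loopPairing_eq_sum (ν : ℂ) {x : ℝ} (hx : 0 < x) (p q : Polynomial ℂ) :
    loopPairing ν (2 * x) p q =
      q.sum fun i b => p.sum fun j a => b * (a * moment ν (2 * x) ((j : ℤ) - i)) := by
  have hint : ∀ μ, Integrable fun u =>
      Complex.exp (x * (hankelLoop u + 1 / hankelLoop u)) * loopKernel μ u :=
    fun μ => (expBounded_loopKernel μ).integrable (by simpa using hx)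
  simp_rw [Polynomial.sum_def, moment_eq_loopMoment, loopMoment, ← integral_const_mul]
  have h1 : ∀ i, ∫ u, (∑ j ∈ p.support, q.coeff i * (p.coeff j *
      (Complex.exp (x * (hankelLoop u + 1 / hankelLoop u)) *
        loopKernel (((j : ℤ) - (i : ℤ) : ℤ) + ν) u))) =
      ∑ j ∈ p.support, ∫ u, q.coeff i * (p.coeff j *
      (Complex.exp (x * (hankelLoop u + 1 / hankelLoop u)) *
        loopKernel (((j : ℤ) - (i : ℤ) : ℤ) + ν) u)) :=
    fun i => integral_finsetSum _ fun j _ => ((hint _).const_mul _).const_mul _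
  simp_rw [← h1]
  rw [← integral_finsetSum _ fun i _ => integrable_finsetSum _ fun j _ =>
    ((hint _).const_mul _).const_mul _]
  refine integral_congr_ae (Eventually.of_forall fun u => ?_)
  simp only [← weight_div_mul_deriv_hankelLoop]
  have hs := hankelLoop_ne_zero u
  rw [Polynomial.eval_eq_sum, Polynomial.eval_eq_sum, Polynomial.sum_def, Polynomial.sum_def]
  rw [mul_comm (∑ j ∈ p.support, _), Finset.sum_mul_sum, Finset.sum_mul, Finset.sum_div,
    Finset.sum_mul]
  refine Finset.sum_congr rfl fun i _ => ?_
  rw [Finset.sum_mul, Finset.sum_div, Finset.sum_mul]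
  refine Finset.sum_congr rfl fun j _ => ?_
  rw [zpow_sub₀ hs, zpow_natCast, zpow_natCast, inv_pow]
  field_simp

/-! ### The moment functional and dual polynomials -/

open Polynomial in
/-- The linear functional `p ↦ ∑_j p_j m_{j-k}`, the pairing of `p(z)` with `z^{-k}`. -/
noncomputable def momentForm (m : ℤ → ℂ) (k : ℤ) : ℂ[X] →ₗ[ℂ] ℂ :=
  lsum fun j => m (j - k) • LinearMap.id

/-- The Toeplitz matrix `(m_{j-i})`. -/
def toeplitzMatrix (m : ℤ → ℂ) (N : ℕ) : Matrix (Fin N) (Fin N) ℂ :=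
  Matrix.of fun i j => m ((j : ℤ) - (i : ℤ))

section MomentForm

open Polynomial

theorem momentForm_monomial (m : ℤ → ℂ) (k : ℤ) (j : ℕ) (a : ℂ) :
    momentForm m k (monomial j a) = m (j - k) * a := by
  simp [momentForm, lsum]

theorem momentForm_X_mul (m : ℤ → ℂ) (k : ℤ) (p : ℂ[X]) :
    momentForm m k (X * p) = momentForm m (k - 1) p := by
  induction p using Polynomial.induction_on' with
  | add p q hp hq => rw [mul_add, map_add, map_add, hp, hq]
  | monomial j a =>
    rw [X_mul_monomial, momentForm_monomial, momentForm_monomial]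
    congr 2
    push_cast; ring

/-- Integration by parts for the functional: the Euler operator `z∂_z` acts on monomials by their
degree, which the moment recurrence trades for shifts of `k`. -/
theorem momentForm_X_mul_derivative {m : ℤ → ℂ} {ν x : ℂ}
    (hm : ∀ k : ℤ, (k + ν) * m k + x * (m (k + 1) - m (k - 1)) = 0) (k : ℤ) (p : ℂ[X]) :
    momentForm m k (X * derivative p) =
      (k - ν) * momentForm m k p - x * (momentForm m (k - 1) p - momentForm m (k + 1) p) := by
  induction p using Polynomial.induction_on' with
  | add p q hp hq => simp only [mul_add, map_add, hp, hq]; ring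
  | monomial j a =>
    have h : X * derivative (monomial j a) = monomial j (j * a) := by
      rw [derivative_monomial, X_mul_monomial]
      cases j with
      | zero => simp
      | succ j => simp [mul_comm]
    have h2 := hm (j - k)
    rw [h]
    simp only [momentForm_monomial]
    rw [show (j : ℤ) - (k - 1) = j - k + 1 by ring, show (j : ℤ) - (k + 1) = j - k - 1 by ring]
    push_cast at h2
    linear_combination a * h2

theorem momentForm_eq_sum (m : ℤ → ℂ) (k : ℤ) {N : ℕ} {p : ℂ[X]} (hp : p ∈ degreeLT ℂ N) :
    momentForm m k p = ∑ j : Fin N, m ((j : ℤ) - k) * p.coeff j := by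
  rw [mem_degreeLT] at hp
  change (p.sum fun j a => m ((j : ℤ) - k) * a) = _
  exact (sum_fin (fun j a => m ((j : ℤ) - k) * a) (by simp) hp).symm

theorem momentForm_eq_mulVec (m : ℤ → ℂ) {N : ℕ} {p : ℂ[X]} (hp : p ∈ degreeLT ℂ N)
    (i : Fin N) : momentForm m i p = (toeplitzMatrix m N).mulVec (fun j => p.coeff j) i :=
  momentForm_eq_sum m i hp

theorem eq_zero_of_momentForm_eq_zero {m : ℤ → ℂ} {N : ℕ} (hD : (toeplitzMatrix m N).det ≠ 0)
    {p : ℂ[X]} (hp : p ∈ degreeLT ℂ N) (h : ∀ k : ℤ, 0 ≤ k → k < N → momentForm m k p = 0) :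
    p = 0 := by
  have h0 : (fun j : Fin N => p.coeff j) = 0 := by
    refine Matrix.eq_zero_of_mulVec_eq_zero hD (funext fun i => ?_)
    rw [← momentForm_eq_mulVec m hp]
    exact h i (by positivity) (by exact_mod_cast i.2)
  rw [mem_degreeLT, degree_lt_iff_coeff_zero] at hp
  ext j
  by_cases hj : j < N
  · exact congrFun h0 ⟨j, hj⟩
  · exact hp j (not_lt.1 hj)

theorem mem_degreeLT_iff_coeff {p : ℂ[X]} {N : ℕ} :
    p ∈ degreeLT ℂ N ↔ ∀ j, N ≤ j → p.coeff j = 0 := by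
  rw [mem_degreeLT, degree_lt_iff_coeff_zero]

theorem X_mul_derivative_coeff (p : ℂ[X]) (j : ℕ) :
    (X * derivative p).coeff j = j * p.coeff j := by
  cases j with
  | zero => simp
  | succ j => rw [coeff_X_mul, coeff_derivative]; push_cast; ring

theorem X_mul_X_mul_derivative_coeff (p : ℂ[X]) (j : ℕ) :
    (X * (X * derivative p)).coeff j = ((j : ℂ) - 1) * (X * p).coeff j := by
  cases j with
  | zero => simp
  | succ j => rw [coeff_X_mul, coeff_X_mul, X_mul_derivative_coeff]; push_cast; ring

/-- The polynomials `u`, `v` of degree at most `n` are dual to `z^{-n}` and `z^0` among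
`z^0, …, z^{-n}` with respect to a nondegenerate moment functional. -/
structure IsDualPair (m : ℤ → ℂ) (n : ℕ) (u v : ℂ[X]) (d e f κ σ : ℂ) : Prop where
  det_ne_zero : (toeplitzMatrix m (n + 1)).det ≠ 0
  u_mem : u ∈ degreeLT ℂ (n + 1)
  v_mem : v ∈ degreeLT ℂ (n + 1)
  u_form : ∀ k : ℤ, 0 ≤ k → k ≤ n → momentForm m k u = if k = n then 1 else 0
  v_form : ∀ k : ℤ, 0 ≤ k → k ≤ n → momentForm m k v = if k = 0 then 1 else 0
  u_last : u.coeff n = d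
  v_zero : v.coeff 0 = d
  u_zero : u.coeff 0 = e
  v_last : v.coeff n = f
  form_u : momentForm m (-1) u = κ
  form_v : momentForm m (n + 1) v = σ
  d_ne_zero : d ≠ 0

namespace IsDualPair

variable {m : ℤ → ℂ} {n : ℕ} {u v : ℂ[X]} {d e f κ σ : ℂ}

/-- The main tool of this part: nondegeneracy reduces every polynomial identity of degree at most
`n` to a comparison of `n + 1` pairings. -/
theorem ext (h : IsDualPair m n u v d e f κ σ) {p q : ℂ[X]} (hp : p ∈ degreeLT ℂ (n + 1))
    (hq : q ∈ degreeLT ℂ (n + 1))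
    (hpq : ∀ k : ℤ, 0 ≤ k → k ≤ n → momentForm m k p = momentForm m k q) : p = q := by
  refine sub_eq_zero.1 (eq_zero_of_momentForm_eq_zero h.det_ne_zero (sub_mem hp hq) ?_)
  intro k hk hk'
  rw [map_sub, hpq k hk (by push_cast at hk'; omega), sub_self]

theorem form_pred_u (h : IsDualPair m n u v d e f κ σ) {k : ℤ} (hk : 0 ≤ k) (hk' : k ≤ n) :
    momentForm m (k - 1) u = κ * if k = 0 then 1 else 0 := by
  by_cases h0 : k = 0
  · rw [h0, zero_sub, h.form_u]; simp
  · rw [h.u_form _ (by omega) (by omega), if_neg (by omega), if_neg h0, mul_zero]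

theorem form_succ_v (h : IsDualPair m n u v d e f κ σ) {k : ℤ} (hk : 0 ≤ k) (hk' : k ≤ n) :
    momentForm m (k + 1) v = σ * if k = n then 1 else 0 := by
  by_cases h0 : k = n
  · rw [h0, h.form_v]; simp
  · rw [h.v_form _ (by omega) (by omega), if_neg (by omega), if_neg h0, mul_zero]

/-- The combination is chosen to have no constant term, so `divX` is genuine division by `z`. -/
theorem X_mul_q (h : IsDualPair m n u v d e f κ σ) :
    X * divX (u - (e / d) • v) = u - (e / d) • v := by
  have h1 := X_mul_divX_add (u - (e / d) • v)
  have h2 : (u - (e / d) • v).coeff 0 = 0 := by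
    rw [coeff_sub, coeff_smul, h.u_zero, h.v_zero, smul_eq_mul, div_mul_cancel₀ _ h.d_ne_zero,
      sub_self]
  rwa [h2, C_0, add_zero] at h1

theorem q_mem (h : IsDualPair m n u v d e f κ σ) :
    divX (u - (e / d) • v) ∈ degreeLT ℂ (n + 1) := by
  have h1 := sub_mem h.u_mem (Submodule.smul_mem _ (e / d) h.v_mem)
  rw [mem_degreeLT_iff_coeff] at h1 ⊢
  intro j hj
  rw [coeff_divX]
  exact h1 _ (by omega)

/-- The coefficients of `z^n` cancel, leaving room for multiplication by `z`. -/
theorem r_mem (h : IsDualPair m n u v d e f κ σ) :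
    X * (v - (f / d) • u) ∈ degreeLT ℂ (n + 1) := by
  have h1 := sub_mem h.v_mem (Submodule.smul_mem _ (f / d) h.u_mem)
  rw [mem_degreeLT_iff_coeff] at h1 ⊢
  rintro (_ | j) hj
  · simp
  rw [coeff_X_mul]
  by_cases hjn : j = n
  · rw [hjn, coeff_sub, coeff_smul, h.u_last, h.v_last, smul_eq_mul,
      div_mul_cancel₀ _ h.d_ne_zero, sub_self]
  · exact h1 _ (by omega)

theorem form_q (h : IsDualPair m n u v d e f κ σ) (k : ℤ) :
    momentForm m k (divX (u - (e / d) • v)) =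
      momentForm m (k + 1) u - e / d * momentForm m (k + 1) v := by
  have h1 := momentForm_X_mul m (k + 1) (divX (u - (e / d) • v))
  rw [h.X_mul_q, add_sub_cancel_right] at h1
  rw [← h1, map_sub, map_smul, smul_eq_mul]

theorem form_r (k : ℤ) : momentForm m k (X * (v - (f / d) • u)) =
    momentForm m (k - 1) v - f / d * momentForm m (k - 1) u := by
  rw [momentForm_X_mul, map_sub, map_smul, smul_eq_mul]

theorem X_mul_derivative_mem {p : ℂ[X]} {N : ℕ} (hp : p ∈ degreeLT ℂ N) :
    X * derivative p ∈ degreeLT ℂ N := by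
  rw [mem_degreeLT_iff_coeff] at hp ⊢
  intro j hj
  rw [X_mul_derivative_coeff, hp j hj, mul_zero]

/-- In the hypothesis on pairings, the shift down by one contributes only `κ` at `k = 0`, a multiple
of `v`. The shift up is division by `z`, corrected by `σ` at `k = n`. -/
theorem time_derivative_u (h : IsDualPair m n u v d e f κ σ) {u' : ℂ[X]}
    (hu : u' ∈ degreeLT ℂ (n + 1)) (hu' : ∀ k : ℤ, 0 ≤ k → k ≤ n →
      momentForm m k u' = -(momentForm m (k - 1) u + momentForm m (k + 1) u)) :
    u' = -(κ • v) - (e / d * σ) • u - divX (u - (e / d) • v) := by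
  refine h.ext hu (sub_mem (sub_mem (neg_mem (Submodule.smul_mem _ _ h.v_mem))
    (Submodule.smul_mem _ _ h.u_mem)) h.q_mem) fun k hk hk' => ?_
  rw [hu' k hk hk', map_sub, map_sub, map_neg, map_smul, map_smul, h.form_q, h.form_pred_u hk hk',
    h.form_succ_v hk hk', h.u_form k hk hk', h.v_form k hk hk']
  simp only [smul_eq_mul]
  ring

theorem time_derivative_v (h : IsDualPair m n u v d e f κ σ) {v' : ℂ[X]}
    (hv : v' ∈ degreeLT ℂ (n + 1)) (hv' : ∀ k : ℤ, 0 ≤ k → k ≤ n →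
      momentForm m k v' = -(momentForm m (k - 1) v + momentForm m (k + 1) v)) :
    v' = -((f / d * κ) • v) - σ • u - X * (v - (f / d) • u) := by
  refine h.ext hv (sub_mem (sub_mem (neg_mem (Submodule.smul_mem _ _ h.v_mem))
    (Submodule.smul_mem _ _ h.u_mem)) h.r_mem) fun k hk hk' => ?_
  rw [hv' k hk hk', map_sub, map_sub, map_neg, map_smul, map_smul, form_r, h.form_pred_u hk hk',
    h.form_succ_v hk hk', h.u_form k hk hk', h.v_form k hk hk']
  simp only [smul_eq_mul]
  ring

variable {ν x : ℂ}

/-- The duality relations turn `k` into `n` in the pairing of `u`; the two shifts are then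
represented as in `time_derivative_u`. -/
theorem X_mul_derivative_u (h : IsDualPair m n u v d e f κ σ)
    (hm : ∀ k : ℤ, (k + ν) * m k + x * (m (k + 1) - m (k - 1)) = 0) :
    X * derivative u = (n - ν) • u - (x * κ) • v + x • divX (u - (e / d) • v) +
      (x * (e / d) * σ) • u := by
  refine h.ext (X_mul_derivative_mem h.u_mem) (add_mem (add_mem (sub_mem
    (Submodule.smul_mem _ _ h.u_mem) (Submodule.smul_mem _ _ h.v_mem))
    (Submodule.smul_mem _ _ h.q_mem)) (Submodule.smul_mem _ _ h.u_mem)) fun k hk hk' => ?_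
  have hk2 : (k : ℂ) * (if k = n then 1 else 0) = n * if k = n then 1 else 0 := by
    split_ifs with hkn
    · rw [hkn]; norm_cast
    · simp
  rw [momentForm_X_mul_derivative hm, map_add, map_add, map_sub, map_smul, map_smul, map_smul,
    map_smul, h.form_q, h.form_pred_u hk hk', h.form_succ_v hk hk', h.u_form k hk hk',
    h.v_form k hk hk']
  simp only [smul_eq_mul]
  linear_combination hk2

theorem X_mul_derivative_v (h : IsDualPair m n u v d e f κ σ)
    (hm : ∀ k : ℤ, (k + ν) * m k + x * (m (k + 1) - m (k - 1)) = 0) :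
    X * derivative v = -(ν • v) - x • (X * (v - (f / d) • u)) - (x * (f / d) * κ) • v +
      (x * σ) • u := by
  refine h.ext (X_mul_derivative_mem h.v_mem) (add_mem (sub_mem (sub_mem (neg_mem
    (Submodule.smul_mem _ _ h.v_mem)) (Submodule.smul_mem _ _ h.r_mem))
    (Submodule.smul_mem _ _ h.v_mem)) (Submodule.smul_mem _ _ h.u_mem)) fun k hk hk' => ?_
  have hk2 : (k : ℂ) * (if k = 0 then 1 else 0) = 0 := by
    split_ifs with hkn
    · rw [hkn]; simp
    · simp
  rw [momentForm_X_mul_derivative hm, map_add, map_sub, map_sub, map_neg, map_smul, map_smul,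
    map_smul, map_smul, form_r, h.form_pred_u hk hk', h.form_succ_v hk hk', h.u_form k hk hk',
    h.v_form k hk hk']
  simp only [smul_eq_mul]
  linear_combination hk2

theorem coeff_q (j : ℕ) : (divX (u - (e / d) • v)).coeff j =
    u.coeff (j + 1) - e / d * v.coeff (j + 1) := by
  simp [coeff_divX]

theorem coeff_r (j : ℕ) : (X * (v - (f / d) • u)).coeff j =
    (X * v).coeff j - f / d * (X * u).coeff j := by
  simp [mul_sub]

theorem q_last (h : IsDualPair m n u v d e f κ σ) : (divX (u - (e / d) • v)).coeff n = 0 := by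
  rw [coeff_q, mem_degreeLT_iff_coeff.1 h.u_mem _ le_rfl, mem_degreeLT_iff_coeff.1 h.v_mem _ le_rfl]
  simp

/-- The coefficient of `z^n` in the Euler equation for `u`. This relation later removes `σ`. -/
theorem constraint (h : IsDualPair m n u v d e f κ σ)
    (hm : ∀ k : ℤ, (k + ν) * m k + x * (m (k + 1) - m (k - 1)) = 0) :
    ν * d = x * (e * σ - κ * f) := by
  have h1 := congrArg (coeff · n) (h.X_mul_derivative_u hm)
  simp only [X_mul_derivative_coeff, coeff_add, coeff_sub, coeff_smul, h.q_last, h.u_last,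
    h.v_last, smul_eq_mul] at h1
  have hd := h.d_ne_zero
  field_simp at h1
  linear_combination h1

theorem u_zero_identity (h : IsDualPair m n u v d e f κ σ)
    (hm : ∀ k : ℤ, (k + ν) * m k + x * (m (k + 1) - m (k - 1)) = 0) :
    x * (u.coeff 1 - e / d * v.coeff 1) =
      x * κ * d - (n - ν) * e - x * σ * e ^ 2 / d := by
  have h1 := congrArg (coeff · 0) (h.X_mul_derivative_u hm)
  simp only [X_mul_derivative_coeff, coeff_add, coeff_sub, coeff_smul, coeff_q, h.u_zero,
    h.v_zero, smul_eq_mul, Nat.cast_zero, zero_mul, zero_add] at h1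
  linear_combination -h1

theorem v_last_identity (h : IsDualPair m n u v d e f κ σ)
    (hm : ∀ k : ℤ, (k + ν) * m k + x * (m (k + 1) - m (k - 1)) = 0) :
    x * ((X * v).coeff n - f / d * (X * u).coeff n) =
      -(n + ν) * f - x * κ * f ^ 2 / d + x * σ * d := by
  have h1 := congrArg (coeff · n) (h.X_mul_derivative_v hm)
  simp only [X_mul_derivative_coeff, coeff_add, coeff_sub, coeff_smul, coeff_r, h.u_last,
    h.v_last, smul_eq_mul, coeff_neg] at h1
  linear_combination h1

theorem subleading_u (h : IsDualPair m n u v d e f κ σ)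
    (hm : ∀ k : ℤ, (k + ν) * m k + x * (m (k + 1) - m (k - 1)) = 0) :
    -(X * u).coeff n = (n + ν) * f * κ + x * κ ^ 2 * f ^ 2 / d - x * σ * κ * d +
      x * (d - e * f / d) := by
  -- Multiplying by `X` first turns the coefficient of `z^{n-1}` into one of index `n`, so `n = 0`
  -- is not special, and it undoes `divX`.
  have h1 := congrArg (coeff · n) (congrArg (X * ·) (h.X_mul_derivative_u hm))
  simp only [mul_add, mul_sub, mul_smul_comm, h.X_mul_q, X_mul_X_mul_derivative_coeff, coeff_add,
    coeff_sub, coeff_smul, h.u_last, h.v_last, smul_eq_mul] at h1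
  have h2 := h.v_last_identity hm
  have h3 := h.constraint hm
  have hd := h.d_ne_zero
  generalize (X * u).coeff n = U at *
  generalize (X * v).coeff n = V at *
  field_simp at h1 h2 ⊢
  linear_combination h1 - κ * h2 - U * h3

theorem subleading_v (h : IsDualPair m n u v d e f κ σ)
    (hm : ∀ k : ℤ, (k + ν) * m k + x * (m (k + 1) - m (k - 1)) = 0) :
    -v.coeff 1 = x * (d - e * f / d) - x * σ * κ * d + (n - ν) * e * σ +
      x * σ ^ 2 * e ^ 2 / d := by
  have h1 := congrArg (coeff · 1) (h.X_mul_derivative_v hm)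
  have h0 : ∀ p : ℂ[X], (X * p).coeff 1 = p.coeff 0 := fun p => coeff_X_mul p 0
  simp only [coeff_add, coeff_sub, coeff_smul, h0, h.u_zero, h.v_zero, smul_eq_mul, coeff_neg,
    coeff_derivative, Nat.cast_zero, zero_add, mul_one] at h1
  have h2 := h.u_zero_identity hm
  have h3 := h.constraint hm
  have hd := h.d_ne_zero
  generalize u.coeff 1 = U at *
  generalize v.coeff 1 = V at *
  field_simp at h1 h2 ⊢
  linear_combination -h1 - σ * h2 + V * h3

theorem time_derivative_d (h : IsDualPair m n u v d e f κ σ) {u' : ℂ[X]}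
    (hu : u' = -(κ • v) - (e / d * σ) • u - divX (u - (e / d) • v)) :
    u'.coeff n = -(κ * f + e * σ) := by
  have hd := h.d_ne_zero
  rw [hu]
  simp only [coeff_sub, coeff_neg, coeff_smul, h.q_last, h.u_last, h.v_last, smul_eq_mul]
  field_simp
  ring

theorem time_derivative_e (h : IsDualPair m n u v d e f κ σ)
    (hm : ∀ k : ℤ, (k + ν) * m k + x * (m (k + 1) - m (k - 1)) = 0) {u' : ℂ[X]}
    (hu : u' = -(κ • v) - (e / d * σ) • u - divX (u - (e / d) • v)) :
    x * u'.coeff 0 = (n - ν) * e - 2 * x * κ * d := by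
  have hd := h.d_ne_zero
  have h2 := h.u_zero_identity hm
  rw [hu]
  simp only [coeff_sub, coeff_neg, coeff_smul, coeff_q, h.u_zero, h.v_zero, smul_eq_mul, zero_add]
  linear_combination -h2

theorem time_derivative_f (h : IsDualPair m n u v d e f κ σ)
    (hm : ∀ k : ℤ, (k + ν) * m k + x * (m (k + 1) - m (k - 1)) = 0) {v' : ℂ[X]}
    (hv : v' = -((f / d * κ) • v) - σ • u - X * (v - (f / d) • u)) :
    x * v'.coeff n = (n + ν) * f - 2 * x * σ * d := by
  have h2 := h.v_last_identity hm
  rw [hv]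
  simp only [coeff_sub, coeff_neg, coeff_smul, coeff_r, h.u_last, h.v_last, smul_eq_mul]
  linear_combination -h2

/-- The pairing at `k = -2` is not among the parameters; the Euler equation paired at `k = -1`
eliminates it. -/
theorem time_derivative_κ (h : IsDualPair m n u v d e f κ σ)
    (hm : ∀ k : ℤ, (k + ν) * m k + x * (m (k + 1) - m (k - 1)) = 0) {u' : ℂ[X]}
    (hu : u' = -(κ • v) - (e / d * σ) • u - divX (u - (e / d) • v)) :
    x * (momentForm m (-1) u' + momentForm m (-2) u + momentForm m 0 u) =
      -(n + 1) * κ + 2 * x * (e / d) * (1 - σ * κ) := by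
  have h1 := momentForm_X_mul_derivative hm (-1) u
  rw [h.X_mul_derivative_u hm] at h1
  have h2 := h.form_q (-1)
  rw [show (-1 : ℤ) + 1 = 0 by norm_num, h.v_form 0 le_rfl (by positivity), if_pos rfl] at h2
  rw [show (-1 : ℤ) + 1 = 0 by norm_num, show (-1 : ℤ) - 1 = -2 by norm_num] at h1
  rw [hu]
  simp only [map_sub, map_add, map_neg, map_smul, smul_eq_mul, h2, h.form_u] at h1 ⊢
  push_cast at h1
  linear_combination h1

end IsDualPair

end MomentForm

/-! ### Analyticity and derivatives of determinants and inverses -/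

section Determinants

theorem analyticAt_det {N : ℕ} {M : ℝ → Matrix (Fin N) (Fin N) ℂ} {x : ℝ}
    (hM : ∀ i j, AnalyticAt ℝ (fun x => M x i j) x) : AnalyticAt ℝ (fun x => (M x).det) x := by
  simp_rw [Matrix.det_apply']
  exact Finset.analyticAt_fun_sum _ fun σ _ =>
    analyticAt_const.mul (Finset.analyticAt_fun_prod _ fun i _ => hM _ _)

theorem analyticAt_inv_apply {N : ℕ} {M : ℝ → Matrix (Fin N) (Fin N) ℂ} {x : ℝ}
    (hM : ∀ i j, AnalyticAt ℝ (fun x => M x i j) x) (h : (M x).det ≠ 0) (i j : Fin N) :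
    AnalyticAt ℝ (fun x => (M x)⁻¹ i j) x := by
  simp_rw [Matrix.inv_def, Matrix.smul_apply, Ring.inverse_eq_inv', Matrix.adjugate_apply,
    smul_eq_mul]
  refine ((analyticAt_det hM).inv h).mul (analyticAt_det fun k l => ?_)
  by_cases hk : k = j
  · subst hk
    simp only [Matrix.updateRow_self]
    exact analyticAt_const
  · simp only [Matrix.updateRow_ne hk]
    exact hM k l

/-- Jacobi's formula: differentiate column by column and evaluate the resulting determinants by
Cramer's rule. -/
theorem hasDerivAt_det {N : ℕ} {M : ℝ → Matrix (Fin N) (Fin N) ℂ} {M' : Matrix (Fin N) (Fin N) ℂ}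
    {x : ℝ} (hM : ∀ i j, HasDerivAt (fun x => M x i j) (M' i j) x) (h : (M x).det ≠ 0) :
    HasDerivAt (fun x => (M x).det) ((M x).det * ((M x)⁻¹ * M').trace) x := by
  have h1 : HasDerivAt (fun x => (M x).det)
      (∑ j, ((M x).updateCol j fun i => M' i j).det) x := by
    simp_rw [Matrix.det_apply']
    refine (HasDerivAt.fun_sum fun σ _ => (HasDerivAt.fun_finsetProd fun i _ =>
      hM (σ i) i).const_mul _).congr_deriv ?_
    rw [Finset.sum_comm]
    refine Finset.sum_congr rfl fun σ _ => ?_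
    rw [Finset.mul_sum]
    refine Finset.sum_congr rfl fun j _ => ?_
    congr 1
    rw [← Finset.mul_prod_erase _ _ (Finset.mem_univ j), Matrix.updateCol_self, smul_eq_mul,
      mul_comm]
    congr 1
    exact Finset.prod_congr rfl fun i hi => (Matrix.updateCol_ne (Finset.ne_of_mem_erase hi)).symm
  refine h1.congr_deriv ?_
  rw [Matrix.trace, Finset.mul_sum]
  refine Finset.sum_congr rfl fun j _ => ?_
  rw [← Matrix.cramer_apply, Matrix.cramer_eq_adjugate_mulVec, Matrix.diag_apply, Matrix.inv_def,
    Ring.inverse_eq_inv', Matrix.smul_mul, Matrix.smul_apply, smul_eq_mul, mul_inv_cancel_left₀ h]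
  rfl

end Determinants

/-! ### Dual polynomials from the inverse Toeplitz matrix -/

section DualPolynomials

open Polynomial

/-- The polynomial whose coefficients form a column of the inverse Toeplitz matrix. -/
noncomputable def dualPoly (m : ℤ → ℂ) (n : ℕ) (k : Fin (n + 1)) : ℂ[X] :=
  ofFn (n + 1) fun j => (toeplitzMatrix m (n + 1))⁻¹ j k

variable {m : ℤ → ℂ} {n : ℕ}

theorem ofFn_mem_degreeLT {N : ℕ} (w : Fin N → ℂ) : ofFn N w ∈ degreeLT ℂ N :=
  mem_degreeLT.2 (ofFn_degree_lt w)

theorem ofFn_coeff_fin {N : ℕ} (w : Fin N → ℂ) (j : Fin N) : (ofFn N w).coeff j = w j :=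
  ofFn_coeff_eq_val_of_lt w j.2

theorem dualPoly_mem (k : Fin (n + 1)) : dualPoly m n k ∈ degreeLT ℂ (n + 1) :=
  ofFn_mem_degreeLT _

theorem dualPoly_coeff (k j : Fin (n + 1)) :
    (dualPoly m n k).coeff j = (toeplitzMatrix m (n + 1))⁻¹ j k :=
  ofFn_coeff_fin _ j

theorem momentForm_dualPoly (h : (toeplitzMatrix m (n + 1)).det ≠ 0) (i k : Fin (n + 1)) :
    momentForm m i (dualPoly m n k) = if i = k then 1 else 0 := by
  rw [momentForm_eq_mulVec m (dualPoly_mem k)]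
  simp_rw [dualPoly_coeff]
  change ((toeplitzMatrix m (n + 1)) * (toeplitzMatrix m (n + 1))⁻¹) i k = _
  rw [Matrix.mul_nonsing_inv _ (isUnit_iff_ne_zero.2 h), Matrix.one_apply]

/-- The corner cofactor is the Toeplitz determinant of the next smaller size, so `d = D_n /
D_{n+1}`; the opposite corner has the same cofactor. -/
theorem inv_last_last (m : ℤ → ℂ) (n : ℕ) :
    (toeplitzMatrix m (n + 1))⁻¹ (Fin.last n) (Fin.last n) =
      (toeplitzMatrix m (n + 1)).det⁻¹ * (toeplitzMatrix m n).det := by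
  rw [Matrix.inv_def, Matrix.smul_apply, Ring.inverse_eq_inv',
    Matrix.adjugate_fin_succ_eq_det_submatrix, Even.neg_one_pow (by simp), one_mul, smul_eq_mul]
  congr 2
  ext i j
  simp [toeplitzMatrix]

theorem inv_zero_zero (m : ℤ → ℂ) (n : ℕ) :
    (toeplitzMatrix m (n + 1))⁻¹ 0 0 =
      (toeplitzMatrix m (n + 1)).det⁻¹ * (toeplitzMatrix m n).det := by
  rw [Matrix.inv_def, Matrix.smul_apply, Ring.inverse_eq_inv',
    Matrix.adjugate_fin_succ_eq_det_submatrix, Even.neg_one_pow (by simp), one_mul, smul_eq_mul]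
  congr 2
  ext i j
  simp [toeplitzMatrix]

theorem isDualPair_dualPoly (h : (toeplitzMatrix m (n + 1)).det ≠ 0)
    (h' : (toeplitzMatrix m n).det ≠ 0) :
    IsDualPair m n (dualPoly m n (Fin.last n)) (dualPoly m n 0)
      ((toeplitzMatrix m (n + 1))⁻¹ (Fin.last n) (Fin.last n))
      ((toeplitzMatrix m (n + 1))⁻¹ 0 (Fin.last n))
      ((toeplitzMatrix m (n + 1))⁻¹ (Fin.last n) 0)
      (momentForm m (-1) (dualPoly m n (Fin.last n)))
      (momentForm m (n + 1) (dualPoly m n 0)) where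
  det_ne_zero := h
  u_mem := dualPoly_mem _
  v_mem := dualPoly_mem _
  u_form k hk hk' := by
    lift k to ℕ using hk
    have := momentForm_dualPoly h ⟨k, by omega⟩ (Fin.last n)
    simpa [Fin.ext_iff] using this
  v_form k hk hk' := by
    lift k to ℕ using hk
    have := momentForm_dualPoly h ⟨k, by omega⟩ 0
    simpa [Fin.ext_iff] using this
  u_last := dualPoly_coeff (Fin.last n) (Fin.last n)
  v_zero := by rw [inv_last_last, ← inv_zero_zero]; exact dualPoly_coeff 0 0
  u_zero := dualPoly_coeff (Fin.last n) 0
  v_last := dualPoly_coeff 0 (Fin.last n)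
  form_u := rfl
  form_v := rfl
  d_ne_zero := by rw [inv_last_last]; exact mul_ne_zero (inv_ne_zero h) h'

/-- The trace of `T⁻¹ T'` for the Toeplitz matrix with moments `m_k' = m_{k+1} + m_{k-1}`. -/
theorem IsDualPair.trace_inv_mul {u v : ℂ[X]} {d e f κ σ : ℂ}
    (h : IsDualPair m n u v d e f κ σ)
    (he : (toeplitzMatrix m (n + 1))⁻¹ 0 (Fin.last n) = e)
    (hf : (toeplitzMatrix m (n + 1))⁻¹ (Fin.last n) 0 = f) :
    ((toeplitzMatrix m (n + 1))⁻¹ *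
      toeplitzMatrix (fun k => m (k + 1) + m (k - 1)) (n + 1)).trace =
      (κ * f - (X * u).coeff n) / d + (σ * e - v.coeff 1) / d := by
  have hd := h.d_ne_zero
  have hT := Matrix.nonsing_inv_mul _ (isUnit_iff_ne_zero.2 h.det_ne_zero)
  set T := toeplitzMatrix m (n + 1) with hTdef
  have hsplit : toeplitzMatrix (fun k => m (k + 1) + m (k - 1)) (n + 1) =
      toeplitzMatrix (fun k => m (k + 1)) (n + 1) + toeplitzMatrix (fun k => m (k - 1)) (n + 1) :=
    rfl
  rw [hsplit, mul_add, Matrix.trace_add]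
  congr 1
  · set A := T⁻¹ * toeplitzMatrix (fun k => m (k + 1)) (n + 1) with hA
    -- Shifting the moments moves the columns of `T` by one, so `A` is a shift matrix except for its
    -- last column, and its trace is a single entry.
    have hcol : ∀ (i : Fin (n + 1)) (j : Fin n), A i j.castSucc = if i = j.succ then 1 else 0 := by
      intro i j
      rw [← Matrix.one_apply, ← hT, hA, Matrix.mul_apply, Matrix.mul_apply]
      refine Finset.sum_congr rfl fun k _ => ?_
      congr 1
      simp only [toeplitzMatrix, hTdef, Matrix.of_apply]
      congr 1
      simp; ring
    -- Applying `A` to the coefficients of `u` reveals that entry: the shifted pairings of `u`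
    -- vanish except for `κ` in position `0`.
    have hvec : A.mulVec (fun j => u.coeff j) (Fin.last n) = κ * f := by
      have h1 : (toeplitzMatrix (fun k => m (k + 1)) (n + 1)).mulVec (fun j => u.coeff j) =
          Pi.single 0 κ := by
        funext i
        have h2 := momentForm_eq_sum m ((i : ℤ) - 1) h.u_mem
        rw [h.form_pred_u (by positivity) (by have := i.2; omega)] at h2
        rw [Pi.single_apply]
        have h3 : ((i : ℕ) : ℤ) = 0 ↔ i = 0 := by rw [Fin.ext_iff]; simp
        simp only [h3, mul_ite, mul_one, mul_zero] at h2
        rw [h2, Matrix.mulVec, dotProduct]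
        refine Finset.sum_congr rfl fun j _ => ?_
        simp only [toeplitzMatrix, Matrix.of_apply]
        congr 2; ring
      rw [hA, ← Matrix.mulVec_mulVec, h1, Matrix.mulVec_single]
      simp [hf, mul_comm]
    have htr : A.trace = A (Fin.last n) (Fin.last n) := by
      rw [Matrix.trace, Fin.sum_univ_castSucc, Finset.sum_eq_zero, zero_add, Matrix.diag_apply]
      intro j _
      rw [Matrix.diag_apply, hcol, if_neg]
      simp [Fin.ext_iff]
    rw [Matrix.mulVec, dotProduct, Fin.sum_univ_castSucc] at hvec
    have hX : ∑ j : Fin n, A (Fin.last n) j.castSucc * u.coeff (j.castSucc : Fin (n + 1)) =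
        (X * u).coeff n := by
      simp_rw [hcol]
      cases n with
      | zero => simp
      | succ n =>
        rw [Fin.sum_univ_castSucc, Finset.sum_eq_zero]
        · simp
        · intro j _
          rw [if_neg, zero_mul]
          rw [Fin.ext_iff]
          have := j.2
          simp; omega
    rw [hX, Fin.val_last, h.u_last] at hvec
    rw [htr, eq_div_iff hd]
    linear_combination hvec
  · set A := T⁻¹ * toeplitzMatrix (fun k => m (k - 1)) (n + 1) with hA
    have hcol : ∀ (i : Fin (n + 1)) (j : Fin n), A i j.succ = if i = j.castSucc then 1 else 0 := by
      intro i j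
      rw [← Matrix.one_apply, ← hT, hA, Matrix.mul_apply, Matrix.mul_apply]
      refine Finset.sum_congr rfl fun k _ => ?_
      congr 1
      simp only [toeplitzMatrix, hTdef, Matrix.of_apply]
      congr 1
      simp; ring
    have hvec : A.mulVec (fun j => v.coeff j) 0 = σ * e := by
      have h1 : (toeplitzMatrix (fun k => m (k - 1)) (n + 1)).mulVec (fun j => v.coeff j) =
          Pi.single (Fin.last n) σ := by
        funext i
        have h2 := momentForm_eq_sum m ((i : ℤ) + 1) h.v_mem
        rw [h.form_succ_v (by positivity) (by have := i.2; omega)] at h2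
        rw [Pi.single_apply]
        have h3 : ((i : ℕ) : ℤ) = n ↔ i = Fin.last n := by rw [Fin.ext_iff]; simp
        simp only [h3, mul_ite, mul_one, mul_zero] at h2
        rw [h2, Matrix.mulVec, dotProduct]
        refine Finset.sum_congr rfl fun j _ => ?_
        simp only [toeplitzMatrix, Matrix.of_apply]
        congr 2; ring
      rw [hA, ← Matrix.mulVec_mulVec, h1, Matrix.mulVec_single]
      simp [he, mul_comm]
    have htr : A.trace = A 0 0 := by
      rw [Matrix.trace, Fin.sum_univ_succ, Finset.sum_eq_zero, add_zero, Matrix.diag_apply]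
      intro j _
      rw [Matrix.diag_apply, hcol, if_neg]
      simp [Fin.ext_iff]
    rw [Matrix.mulVec, dotProduct, Fin.sum_univ_succ] at hvec
    have hX : ∑ j : Fin n, A 0 j.succ * v.coeff (j.succ : Fin (n + 1)) = v.coeff 1 := by
      simp_rw [hcol]
      cases n with
      | zero => simpa using (mem_degreeLT_iff_coeff.1 h.v_mem 1 le_rfl).symm
      | succ n =>
        rw [Fin.sum_univ_succ, Finset.sum_eq_zero]
        · simp
        · intro j _
          rw [if_neg, zero_mul]
          simp [Fin.ext_iff]
    rw [hX, Fin.val_zero, h.v_zero] at hvec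
    rw [htr, eq_div_iff hd]
    linear_combination hvec

end DualPolynomials

/-! ### Orthogonal polynomials in terms of the dual pair -/

section OrthogonalPolynomials

open Polynomial

variable {ν : ℂ} {n : ℕ} {x : ℝ}

theorem isMonicOP_iff (hx : 0 < x) {p : ℂ[X]} : IsMonicOP n ν (2 * x) p ↔
    p.Monic ∧ p.natDegree = n ∧ ∀ k : ℕ, k < n → momentForm (moment ν (2 * x)) k p = 0 := by
  have hsum : ∀ q : ℂ[X], loopPairing ν (2 * x) p q =
      q.sum fun i b => b * momentForm (moment ν (2 * x)) i p := by
    intro q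
    rw [loopPairing_eq_sum ν hx]
    simp only [Polynomial.sum_def]
    refine Finset.sum_congr rfl fun i _ => ?_
    rw [← Finset.mul_sum]
    congr 1
    refine Finset.sum_congr rfl fun j _ => mul_comm _ _
  refine and_congr_right fun _ => and_congr_right fun _ => ⟨fun h k hk => ?_, fun h q hq => ?_⟩
  · have := h (X ^ k) (by rw [degree_X_pow]; exact_mod_cast hk)
    rw [hsum, ← monomial_one_right_eq_X_pow, sum_monomial_index] at this
    · simpa using this
    · simp
  · rw [hsum, Polynomial.sum_def]
    refine Finset.sum_eq_zero fun i hi => ?_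
    rw [h i, mul_zero]
    exact_mod_cast (le_degree_of_mem_supp i hi).trans_lt hq

/-- Two monic candidates differ by a polynomial of degree below `n` with `n` vanishing pairings, so
the choice in `monicOP` is immaterial. -/
theorem monicOP_eq (hx : 0 < x) (hD : toeplitzDet n ν (2 * x) ≠ 0) {p : ℂ[X]}
    (hp : IsMonicOP n ν (2 * x) p) : monicOP n ν (2 * x) = p := by
  have hex : ∃ p, IsMonicOP n ν (2 * x) p := ⟨p, hp⟩
  rw [monicOP, dif_pos hex]
  have hq := hex.choose_spec
  generalize hex.choose = q at hq
  rw [isMonicOP_iff hx] at hp hq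
  obtain ⟨hpm, hpd, hp⟩ := hp
  obtain ⟨hqm, hqd, hq⟩ := hq
  refine sub_eq_zero.1 (eq_zero_of_momentForm_eq_zero (m := moment ν (2 * x)) hD ?_ ?_)
  · rw [mem_degreeLT]
    have hdeg : q.degree = p.degree := by
      rw [degree_eq_natDegree hqm.ne_zero, degree_eq_natDegree hpm.ne_zero, hpd, hqd]
    have h := degree_sub_lt_left hdeg hqm.ne_zero (hqm.leadingCoeff.trans hpm.leadingCoeff.symm)
    rwa [degree_eq_natDegree hqm.ne_zero, hqd] at h
  · intro k hk hk'
    lift k to ℕ using hk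
    rw [map_sub, hp k (by omega), hq k (by omega), sub_self]

variable {u v : ℂ[X]} {d e f κ σ : ℂ}

theorem monic_natDegree_of_coeff {p : ℂ[X]} {N : ℕ} (h : p.coeff N = 1)
    (hp : ∀ j, N + 1 ≤ j → p.coeff j = 0) : p.Monic ∧ p.natDegree = N := by
  have hle : p.natDegree ≤ N := natDegree_le_iff_coeff_eq_zero.2 fun j hj => hp j hj
  exact ⟨monic_of_natDegree_le_of_coeff_eq_one N hle h,
    le_antisymm hle (le_natDegree_of_ne_zero (by rw [h]; exact one_ne_zero))⟩

theorem IsDualPair.monicOP_eval_zero (h : IsDualPair (moment ν (2 * x)) n u v d e f κ σ)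
    (hx : 0 < x) (hD : toeplitzDet n ν (2 * x) ≠ 0) :
    (monicOP n ν (2 * x)).eval 0 = e / d := by
  have hop : IsMonicOP n ν (2 * x) (d⁻¹ • u) := by
    rw [isMonicOP_iff hx, ← and_assoc]
    refine ⟨monic_natDegree_of_coeff ?_ fun j hj => ?_, fun k hk => ?_⟩
    · rw [coeff_smul, h.u_last, smul_eq_mul, inv_mul_cancel₀ h.d_ne_zero]
    · rw [coeff_smul, mem_degreeLT_iff_coeff.1 h.u_mem j hj, smul_zero]
    · rw [map_smul, h.u_form k (by positivity) (by exact_mod_cast hk.le), if_neg, smul_zero]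
      exact_mod_cast hk.ne
  rw [monicOP_eq hx hD hop, eval_smul, ← coeff_zero_eq_eval_zero, h.u_zero, smul_eq_mul,
    div_eq_inv_mul]

theorem IsDualPair.monicOP_succ_eval_zero (h : IsDualPair (moment ν (2 * x)) n u v d e f κ σ)
    (hx : 0 < x) : (monicOP (n + 1) ν (2 * x)).eval 0 = -κ := by
  have hd := h.d_ne_zero
  -- Multiplying `u / d` by `z` destroys orthogonality only at `k = 0`, where the pairing becomes `κ
  -- / d`; subtracting `(κ / d) v` repairs it.
  have hop : IsMonicOP (n + 1) ν (2 * x) (X * (d⁻¹ • u) - (κ / d) • v) := by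
    rw [isMonicOP_iff hx, ← and_assoc]
    refine ⟨monic_natDegree_of_coeff ?_ fun j hj => ?_, fun k hk => ?_⟩
    · rw [coeff_sub, coeff_X_mul, coeff_smul, coeff_smul, h.u_last, smul_eq_mul,
        mem_degreeLT_iff_coeff.1 h.v_mem _ le_rfl, smul_zero, sub_zero, inv_mul_cancel₀ hd]
    · obtain ⟨j, rfl⟩ : ∃ i, j = i + 1 := ⟨j - 1, by omega⟩
      rw [coeff_sub, coeff_X_mul, coeff_smul, coeff_smul,
        mem_degreeLT_iff_coeff.1 h.u_mem _ (by omega),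
        mem_degreeLT_iff_coeff.1 h.v_mem _ (by omega), smul_zero, smul_zero, sub_zero]
    · rw [map_sub, momentForm_X_mul, map_smul, map_smul,
        h.form_pred_u (by positivity) (by omega), h.v_form k (by positivity) (by omega)]
      simp only [smul_eq_mul]
      ring
  rw [monicOP_eq hx h.det_ne_zero hop, eval_sub, eval_mul, eval_X, zero_mul, zero_sub, eval_smul,
    ← coeff_zero_eq_eval_zero, h.v_zero, smul_eq_mul, div_mul_cancel₀ _ hd]

theorem IsDualPair.ratioA_eq (h : IsDualPair (moment ν (2 * x)) n u v d e f κ σ)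
    (hx : 0 < x) (hD : toeplitzDet n ν (2 * x) ≠ 0) :
    ratioA n ν x = κ * d / e := by
  rw [ratioA, h.monicOP_eval_zero hx hD, h.monicOP_succ_eval_zero hx, div_div_eq_mul_div,
    neg_mul, neg_div, neg_neg]

end OrthogonalPolynomials

/-! ### First-order system, Painlevé III and the derivative of `D_n` -/

section TimeEvolution

open Polynomial

variable (n : ℕ) (ν : ℂ)

/-- The inverse of the Toeplitz matrix of size `n + 1` at time `x = t / 2`. -/
noncomputable def toeplitzInv (x : ℝ) : Matrix (Fin (n + 1)) (Fin (n + 1)) ℂ :=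
  (toeplitzMatrix (moment ν (2 * x)) (n + 1))⁻¹

/-- The coefficient of `z^n` in the polynomial dual to `z^{-n}`. -/
noncomputable def invLast (x : ℝ) : ℂ := toeplitzInv n ν x (Fin.last n) (Fin.last n)

/-- The constant term of the polynomial dual to `z^{-n}`. -/
noncomputable def invTop (x : ℝ) : ℂ := toeplitzInv n ν x 0 (Fin.last n)

/-- The coefficient of `z^n` in the polynomial dual to `z^0`. -/
noncomputable def invBot (x : ℝ) : ℂ := toeplitzInv n ν x (Fin.last n) 0

/-- The pairing with `z` of the polynomial dual to `z^{-n}`. -/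
noncomputable def formLast (x : ℝ) : ℂ :=
  momentForm (moment ν (2 * x)) (-1) (dualPoly (moment ν (2 * x)) n (Fin.last n))

/-- The pairing with `z^{-n-1}` of the polynomial dual to `z^0`. -/
noncomputable def formZero (x : ℝ) : ℂ :=
  momentForm (moment ν (2 * x)) (n + 1) (dualPoly (moment ν (2 * x)) n 0)

/-- The auxiliary function that forms a first-order system with `a_n`. -/
noncomputable def auxS (x : ℝ) : ℂ := invTop n ν x * invBot n ν x / invLast n ν x ^ 2

variable {n ν} {x : ℝ}

theorem analyticAt_toeplitzDet (N : ℕ) (hx : 0 < x) :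
    AnalyticAt ℝ (fun x => toeplitzDet N ν (2 * x)) x :=
  analyticAt_det (M := fun x => toeplitzMatrix (moment ν (2 * x)) N)
    fun i j => analyticAt_moment ν ((j : ℤ) - (i : ℤ)) hx

theorem analyticAt_toeplitzInv (hx : 0 < x) (h1 : toeplitzDet (n + 1) ν (2 * x) ≠ 0)
    (i j : Fin (n + 1)) : AnalyticAt ℝ (fun x => toeplitzInv n ν x i j) x :=
  analyticAt_inv_apply (M := fun x => toeplitzMatrix (moment ν (2 * x)) (n + 1))
    (fun i j => analyticAt_moment ν ((j : ℤ) - (i : ℤ)) hx) h1 i j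

theorem eventually_toeplitzDet_ne_zero (N : ℕ) (hx : 0 < x) (h : toeplitzDet N ν (2 * x) ≠ 0) :
    ∀ᶠ y in 𝓝 x, 0 < y ∧ toeplitzDet N ν (2 * y) ≠ 0 :=
  (lt_mem_nhds hx).and
    ((analyticAt_toeplitzDet N hx).continuousAt.eventually_ne h)

theorem hasDerivAt_momentForm_ofFn {N : ℕ} {w : ℝ → Fin N → ℂ} {w' : Fin N → ℂ} (k : ℤ)
    (hx : 0 < x) (hw : ∀ j, HasDerivAt (fun x => w x j) (w' j) x) :
    HasDerivAt (fun x => momentForm (moment ν (2 * x)) k (ofFn N (w x)))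
      (momentForm (moment ν (2 * x)) k (ofFn N w') +
        momentForm (moment ν (2 * x)) (k - 1) (ofFn N (w x)) +
        momentForm (moment ν (2 * x)) (k + 1) (ofFn N (w x))) x := by
  simp_rw [momentForm_eq_sum _ _ (ofFn_mem_degreeLT _), ofFn_coeff_fin]
  refine (HasDerivAt.fun_sum fun (j : Fin N) _ =>
    (hasDerivAt_moment ν ((j : ℤ) - k) hx).mul (hw j)).congr_deriv ?_
  rw [← Finset.sum_add_distrib, ← Finset.sum_add_distrib]
  refine Finset.sum_congr rfl fun j _ => ?_
  rw [show (j : ℤ) - (k - 1) = j - k + 1 by ring, show (j : ℤ) - (k + 1) = j - k - 1 by ring]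
  ring

/-- The time derivative of a dual polynomial. -/
noncomputable def dualPolyDeriv (n : ℕ) (ν : ℂ) (x : ℝ) (k : Fin (n + 1)) : ℂ[X] :=
  ofFn (n + 1) fun j => deriv (fun x => toeplitzInv n ν x j k) x

theorem hasDerivAt_toeplitzInv (hx : 0 < x) (h1 : toeplitzDet (n + 1) ν (2 * x) ≠ 0)
    (j k : Fin (n + 1)) :
    HasDerivAt (fun x => toeplitzInv n ν x j k) ((dualPolyDeriv n ν x k).coeff j) x := by
  rw [dualPolyDeriv, ofFn_coeff_fin]
  exact (analyticAt_toeplitzInv hx h1 j k).differentiableAt.hasDerivAt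

theorem hasDerivAt_momentForm_dualPoly (k : ℤ) (hx : 0 < x)
    (h1 : toeplitzDet (n + 1) ν (2 * x) ≠ 0) (l : Fin (n + 1)) :
    HasDerivAt (fun x => momentForm (moment ν (2 * x)) k (dualPoly (moment ν (2 * x)) n l))
      (momentForm (moment ν (2 * x)) k (dualPolyDeriv n ν x l) +
        momentForm (moment ν (2 * x)) (k - 1) (dualPoly (moment ν (2 * x)) n l) +
        momentForm (moment ν (2 * x)) (k + 1) (dualPoly (moment ν (2 * x)) n l)) x :=
  hasDerivAt_momentForm_ofFn k hx fun j =>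
    (analyticAt_toeplitzInv hx h1 j l).differentiableAt.hasDerivAt

/-- The pairings in the duality range are locally constant in `x`, so the product rule balances the
derivative of the coefficients against that of the moments. -/
theorem momentForm_dualPolyDeriv (hx : 0 < x) (h1 : toeplitzDet (n + 1) ν (2 * x) ≠ 0)
    (l : Fin (n + 1)) (k : ℤ) (hk : 0 ≤ k) (hk' : k ≤ n) :
    momentForm (moment ν (2 * x)) k (dualPolyDeriv n ν x l) =
      -(momentForm (moment ν (2 * x)) (k - 1) (dualPoly (moment ν (2 * x)) n l) +
        momentForm (moment ν (2 * x)) (k + 1) (dualPoly (moment ν (2 * x)) n l)) := by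
  have h := hasDerivAt_momentForm_dualPoly k hx h1 l
  lift k to ℕ using hk
  have hev : (fun x => momentForm (moment ν (2 * x)) k (dualPoly (moment ν (2 * x)) n l)) =ᶠ[𝓝 x]
      fun _ => if (⟨k, by omega⟩ : Fin (n + 1)) = l then 1 else 0 := by
    filter_upwards [eventually_toeplitzDet_ne_zero (n + 1) hx h1] with y hy
    exact momentForm_dualPoly hy.2 ⟨k, by omega⟩ l
  have h0 := h.unique ((hasDerivAt_const x _).congr_of_eventuallyEq hev)
  linear_combination h0

theorem isDualPair_moment (h0 : toeplitzDet n ν (2 * x) ≠ 0)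
    (h1 : toeplitzDet (n + 1) ν (2 * x) ≠ 0) :
    IsDualPair (moment ν (2 * x)) n (dualPoly (moment ν (2 * x)) n (Fin.last n))
      (dualPoly (moment ν (2 * x)) n 0) (invLast n ν x) (invTop n ν x) (invBot n ν x)
      (formLast n ν x) (formZero n ν x) :=
  isDualPair_dualPoly h1 h0

theorem dualPolyDeriv_mem (l : Fin (n + 1)) : dualPolyDeriv n ν x l ∈ degreeLT ℂ (n + 1) :=
  ofFn_mem_degreeLT _

theorem hasDerivAt_invLast (hx : 0 < x) (h0 : toeplitzDet n ν (2 * x) ≠ 0)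
    (h1 : toeplitzDet (n + 1) ν (2 * x) ≠ 0) : HasDerivAt (invLast n ν)
      (-(formLast n ν x * invBot n ν x + invTop n ν x * formZero n ν x)) x := by
  have h := isDualPair_moment h0 h1
  have hu := h.time_derivative_u (dualPolyDeriv_mem _) (momentForm_dualPolyDeriv hx h1 _)
  exact (hasDerivAt_toeplitzInv hx h1 _ _).congr_deriv (h.time_derivative_d hu)

theorem hasDerivAt_invTop (hx : 0 < x) (h0 : toeplitzDet n ν (2 * x) ≠ 0)
    (h1 : toeplitzDet (n + 1) ν (2 * x) ≠ 0) : HasDerivAt (invTop n ν)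
      (((n - ν) * invTop n ν x - 2 * x * formLast n ν x * invLast n ν x) / x) x := by
  have h := isDualPair_moment h0 h1
  have hu := h.time_derivative_u (dualPolyDeriv_mem _) (momentForm_dualPolyDeriv hx h1 _)
  refine (hasDerivAt_toeplitzInv hx h1 _ _).congr_deriv ?_
  rw [eq_div_iff (by exact_mod_cast hx.ne'), mul_comm]
  exact h.time_derivative_e (fun k => moment_recurrence ν k hx) hu

theorem hasDerivAt_invBot (hx : 0 < x) (h0 : toeplitzDet n ν (2 * x) ≠ 0)
    (h1 : toeplitzDet (n + 1) ν (2 * x) ≠ 0) : HasDerivAt (invBot n ν)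
      (((n + ν) * invBot n ν x - 2 * x * formZero n ν x * invLast n ν x) / x) x := by
  have h := isDualPair_moment h0 h1
  have hv := h.time_derivative_v (dualPolyDeriv_mem _) (momentForm_dualPolyDeriv hx h1 _)
  refine (hasDerivAt_toeplitzInv hx h1 _ _).congr_deriv ?_
  rw [eq_div_iff (by exact_mod_cast hx.ne'), mul_comm]
  exact h.time_derivative_f (fun k => moment_recurrence ν k hx) hv

theorem hasDerivAt_formLast (hx : 0 < x) (h0 : toeplitzDet n ν (2 * x) ≠ 0)
    (h1 : toeplitzDet (n + 1) ν (2 * x) ≠ 0) : HasDerivAt (formLast n ν)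
      ((-(n + 1) * formLast n ν x + 2 * x * (invTop n ν x / invLast n ν x) *
        (1 - formZero n ν x * formLast n ν x)) / x) x := by
  have h := isDualPair_moment h0 h1
  have hu := h.time_derivative_u (dualPolyDeriv_mem _) (momentForm_dualPolyDeriv hx h1 _)
  refine (hasDerivAt_momentForm_dualPoly (-1) hx h1 _).congr_deriv ?_
  rw [eq_div_iff (by exact_mod_cast hx.ne'), mul_comm]
  exact h.time_derivative_κ (fun k => moment_recurrence ν k hx) hu

theorem mem_regularSet_iff : x ∈ regularSet n ν ↔ 0 < x ∧ toeplitzDet n ν (2 * x) ≠ 0 ∧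
    toeplitzDet (n + 1) ν (2 * x) ≠ 0 ∧ invTop n ν x ≠ 0 := by
  refine and_congr_right fun hx => and_congr_right fun h0 => and_congr_right fun h1 => ?_
  have h := isDualPair_moment h0 h1
  rw [h.monicOP_eval_zero hx h0, Ne, div_eq_zero_iff, or_iff_left h.d_ne_zero]

theorem isOpen_regularSet : IsOpen (regularSet n ν) := by
  rw [isOpen_iff_mem_nhds]
  intro x hx
  obtain ⟨hx, h0, h1, he⟩ := mem_regularSet_iff.1 hx
  filter_upwards [eventually_toeplitzDet_ne_zero n hx h0,
    eventually_toeplitzDet_ne_zero (n + 1) hx h1,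
    (analyticAt_toeplitzInv hx h1 0 (Fin.last n)).continuousAt.eventually_ne he] with y h2 h3 h4
  exact mem_regularSet_iff.2 ⟨h2.1, h2.2, h3.2, h4⟩

theorem ratioA_eq (hx : x ∈ regularSet n ν) :
    ratioA n ν x = formLast n ν x * invLast n ν x / invTop n ν x := by
  obtain ⟨hx, h0, h1, he⟩ := mem_regularSet_iff.1 hx
  exact (isDualPair_moment h0 h1).ratioA_eq hx h0

theorem ratioA_eventuallyEq (hx : x ∈ regularSet n ν) :
    ratioA n ν =ᶠ[𝓝 x] fun x => formLast n ν x * invLast n ν x / invTop n ν x := by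
  filter_upwards [isOpen_regularSet.mem_nhds hx] with y hy using ratioA_eq hy

theorem analyticAt_formLast (hx : 0 < x) (h1 : toeplitzDet (n + 1) ν (2 * x) ≠ 0) :
    AnalyticAt ℝ (formLast n ν) x := by
  have h : formLast n ν = fun x => ∑ j : Fin (n + 1),
      moment ν (2 * x) ((j : ℤ) - (-1)) * toeplitzInv n ν x j (Fin.last n) := by
    funext x
    rw [formLast, momentForm_eq_sum _ _ (dualPoly_mem _)]
    simp_rw [dualPoly_coeff]
    rfl
  rw [h]
  exact Finset.analyticAt_fun_sum _ fun j _ =>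
    (analyticAt_moment ν _ hx).mul (analyticAt_toeplitzInv hx h1 _ _)

theorem analyticAt_ratioA (hx : x ∈ regularSet n ν) : AnalyticAt ℝ (ratioA n ν) x := by
  refine AnalyticAt.congr ?_ (ratioA_eventuallyEq hx).symm
  obtain ⟨hx, h0, h1, he⟩ := mem_regularSet_iff.1 hx
  exact ((analyticAt_formLast hx h1).mul (analyticAt_toeplitzInv hx h1 _ _)).div
    (analyticAt_toeplitzInv hx h1 _ _) he

/-- The Riccati equation of `a_n`. -/
theorem hasDerivAt_ratioA (hx : x ∈ regularSet n ν) : HasDerivAt (ratioA n ν)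
    (2 - (2 * ν + 2 * n + 1) * ratioA n ν x / x +
      (2 - 4 * auxS n ν x) * ratioA n ν x ^ 2) x := by
  have hr := ratioA_eq hx
  have hev := ratioA_eventuallyEq hx
  obtain ⟨hx, h0, h1, he⟩ := mem_regularSet_iff.1 hx
  have hd := (isDualPair_moment h0 h1).d_ne_zero
  have hc := (isDualPair_moment h0 h1).constraint (fun k => moment_recurrence ν k hx)
  have hx' : (x : ℂ) ≠ 0 := by exact_mod_cast hx.ne'
  refine ((((hasDerivAt_formLast hx h0 h1).mul (hasDerivAt_invLast hx h0 h1)).div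
    (hasDerivAt_invTop hx h0 h1) he).congr_of_eventuallyEq hev).congr_deriv ?_
  rw [hr, auxS]
  simp only [Pi.mul_apply]
  generalize invLast n ν x = d at *
  generalize invTop n ν x = e at *
  generalize invBot n ν x = f at *
  generalize formLast n ν x = κ at *
  generalize formZero n ν x = σ at *
  field_simp
  -- The constraint removes `σ`, and `e f` enters only through `s = e f / d²`.
  linear_combination (3 * κ * e) * hc

theorem hasDerivAt_auxS (hx : x ∈ regularSet n ν) : HasDerivAt (auxS n ν)
    ((2 * (n + ν) * auxS n ν x - 2 * ν) / x -
      4 * ratioA n ν x * auxS n ν x * (1 - auxS n ν x)) x := by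
  have hr := ratioA_eq hx
  obtain ⟨hx, h0, h1, he⟩ := mem_regularSet_iff.1 hx
  have hd := (isDualPair_moment h0 h1).d_ne_zero
  have hc := (isDualPair_moment h0 h1).constraint (fun k => moment_recurrence ν k hx)
  have hx' : (x : ℂ) ≠ 0 := by exact_mod_cast hx.ne'
  refine (((hasDerivAt_invTop hx h0 h1).mul (hasDerivAt_invBot hx h0 h1)).div
    ((hasDerivAt_invLast hx h0 h1).pow 2) (pow_ne_zero 2 hd)).congr_deriv ?_
  rw [hr, auxS]
  simp only [Pi.mul_apply, Pi.pow_apply]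
  generalize invLast n ν x = d at *
  generalize invTop n ν x = e at *
  generalize invBot n ν x = f at *
  generalize formLast n ν x = κ at *
  generalize formZero n ν x = σ at *
  field_simp
  push_cast
  linear_combination (2 * d * (d ^ 2 - e * f)) * hc

theorem toeplitzDet_eq_mul_invLast (h1 : toeplitzDet (n + 1) ν (2 * x) ≠ 0) :
    toeplitzDet n ν (2 * x) = toeplitzDet (n + 1) ν (2 * x) * invLast n ν x := by
  have h2 := inv_last_last (moment ν (2 * x)) n
  change invLast n ν x = (toeplitzDet (n + 1) ν (2 * x))⁻¹ * toeplitzDet n ν (2 * x) at h2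
  rw [h2, mul_inv_cancel_left₀ h1]

theorem hasDerivAt_toeplitzDet_succ (hx : 0 < x) (h0 : toeplitzDet n ν (2 * x) ≠ 0)
    (h1 : toeplitzDet (n + 1) ν (2 * x) ≠ 0) :
    HasDerivAt (fun x => toeplitzDet (n + 1) ν (2 * x)) (toeplitzDet (n + 1) ν (2 * x) *
      ((formLast n ν x * invBot n ν x + ((n + ν) * invBot n ν x * formLast n ν x +
        x * formLast n ν x ^ 2 * invBot n ν x ^ 2 / invLast n ν x -
        x * formZero n ν x * formLast n ν x * invLast n ν x +
        x * (invLast n ν x - invTop n ν x * invBot n ν x / invLast n ν x))) / invLast n ν x +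
      (formZero n ν x * invTop n ν x +
        (x * (invLast n ν x - invTop n ν x * invBot n ν x / invLast n ν x) -
        x * formZero n ν x * formLast n ν x * invLast n ν x +
        (n - ν) * invTop n ν x * formZero n ν x +
        x * formZero n ν x ^ 2 * invTop n ν x ^ 2 / invLast n ν x)) / invLast n ν x)) x := by
  have h := isDualPair_moment h0 h1
  have hdet := hasDerivAt_det (M := fun x => toeplitzMatrix (moment ν (2 * x)) (n + 1))
    (M' := toeplitzMatrix (fun k => moment ν (2 * x) (k + 1) + moment ν (2 * x) (k - 1)) (n + 1))
    (fun i j => hasDerivAt_moment ν ((j : ℤ) - (i : ℤ)) hx) h1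
  refine hdet.congr_deriv ?_
  rw [h.trace_inv_mul rfl rfl, ← h.subleading_u (fun k => moment_recurrence ν k hx),
    ← h.subleading_v (fun k => moment_recurrence ν k hx), ← sub_eq_add_neg, ← sub_eq_add_neg]
  rfl

/-- Writing `D_n = D_{n+1} d` combines the trace formula at size `n + 1` with the derivative of `d`.
-/
theorem hasDerivAt_toeplitzDet (hx : x ∈ regularSet n ν) :
    HasDerivAt (fun x => toeplitzDet n ν (2 * x)) (toeplitzDet n ν (2 * x) *
      (2 * (n + ν) * ratioA n ν x * auxS n ν x -
        2 * x * ratioA n ν x ^ 2 * auxS n ν x * (1 - auxS n ν x) - 2 * ν * ratioA n ν x +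
        2 * x * (1 - auxS n ν x) + n * ν / x)) x := by
  have hr := ratioA_eq hx
  obtain ⟨hx, h0, h1, he⟩ := mem_regularSet_iff.1 hx
  have hd := (isDualPair_moment h0 h1).d_ne_zero
  have hc := (isDualPair_moment h0 h1).constraint (fun k => moment_recurrence ν k hx)
  have hx' : (x : ℂ) ≠ 0 := by exact_mod_cast hx.ne'
  have hev : (fun x => toeplitzDet n ν (2 * x)) =ᶠ[𝓝 x]
      fun x => toeplitzDet (n + 1) ν (2 * x) * invLast n ν x := by
    filter_upwards [eventually_toeplitzDet_ne_zero (n + 1) hx h1] with y hy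
    exact toeplitzDet_eq_mul_invLast hy.2
  refine (((hasDerivAt_toeplitzDet_succ hx h0 h1).mul
    (hasDerivAt_invLast hx h0 h1)).congr_of_eventuallyEq hev).congr_deriv ?_
  rw [hr, auxS, toeplitzDet_eq_mul_invLast h1]
  -- The constraint is solved for `σ`, which requires `e ≠ 0`, that is, `π_n(0) ≠ 0`.
  have hσ : formZero n ν x = (ν * invLast n ν x + x * formLast n ν x * invBot n ν x) /
      (x * invTop n ν x) := by
    rw [eq_div_iff (mul_ne_zero hx' he)]
    linear_combination -hc
  rw [hσ]
  generalize toeplitzDet (n + 1) ν (2 * x) = D at *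
  generalize invLast n ν x = d at *
  generalize invTop n ν x = e at *
  generalize invBot n ν x = f at *
  generalize formLast n ν x = κ at *
  field_simp
  ring

/-- The Painlevé III equation of `a_n`. -/
theorem painleve_ratioA (hx : x ∈ regularSet n ν) (hy : ratioA n ν x ≠ 0) :
    deriv (deriv (ratioA n ν)) x =
      (deriv (ratioA n ν) x) ^ 2 / ratioA n ν x - deriv (ratioA n ν) x / (x : ℂ)
        + 4 / (x : ℂ) * ((ν - n) * ratioA n ν x ^ 2 + n + ν + 1)
        + 4 * ratioA n ν x ^ 3 - 4 / ratioA n ν x := by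
  have hx' : (x : ℂ) ≠ 0 := by exact_mod_cast hx.1.ne'
  have hev : deriv (ratioA n ν) =ᶠ[𝓝 x] fun x => 2 - (2 * ν + 2 * n + 1) * ratioA n ν x / x +
      (2 - 4 * auxS n ν x) * ratioA n ν x ^ 2 := by
    filter_upwards [isOpen_regularSet.mem_nhds hx] with y hy using (hasDerivAt_ratioA hy).deriv
  have hA := hasDerivAt_ratioA hx
  have h2 := ((((hA.const_mul (2 * ν + 2 * n + 1)).div
    (hasDerivAt_id x).ofReal_comp hx').const_sub 2).add
    ((((hasDerivAt_auxS hx).const_mul 4).const_sub 2).mul (hA.pow 2)))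
  rw [(h2.congr_of_eventuallyEq hev).deriv, hA.deriv]
  simp only [id, Pi.pow_apply]
  push_cast
  -- Both derivatives of `a_n` are now rational in `x, y, s`, and `s` cancels from the equation
  -- identically.
  generalize ratioA n ν x = y at *
  generalize auxS n ν x = s at *
  field_simp
  ring

end TimeEvolution

/-! ### Formal solutions at an irregular singularity of rank two -/

section FormalSolutions

open PowerSeries

/-- One column of the recursion for the coefficients of a formal solution: the pair of consecutive
coefficient vectors. -/
noncomputable def formalStep (a κ θ m₁ m₂ n₁ n₂ n₃ n₄ : ℂ) (k : ℕ)
    (s : (ℂ × ℂ) × ℂ × ℂ) : (ℂ × ℂ) × ℂ × ℂ :=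
  let h := (-(κ * k + 2 * θ) * s.2.2 + m₂ * s.2.1 + n₃ * s.1.1 + n₄ * s.1.2) / (2 * a)
  (s.2, (m₁ * h + n₁ * s.2.1 + n₂ * s.2.2) / (κ * (k + 1)), h)

/-- The off-diagonal coefficient of each order is obtained by dividing by the eigenvalue gap `2a`,
and then the diagonal one by dividing by `κ(k+1)`. -/
theorem exists_formal_column {a κ : ℂ} (ha : a ≠ 0) (hκ : κ ≠ 0) (θ m₁ m₂ n₁ n₂ n₃ n₄ : ℂ) :
    ∃ f h : ℂ⟦X⟧, constantCoeff f = 1 ∧ constantCoeff h = 0 ∧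
      C κ * (X ^ 2 * PowerSeries.derivative ℂ f) =
        X * (C m₁ * h) + X ^ 2 * (C n₁ * f + C n₂ * h) ∧
      C κ * (X ^ 2 * PowerSeries.derivative ℂ h) + C (2 * a) * h + X * (C (2 * θ) * h) =
        X * (C m₂ * f) + X ^ 2 * (C n₃ * f + C n₄ * h) := by
  let S : ℕ → (ℂ × ℂ) × ℂ × ℂ := fun k =>
    -- The state at `k` is `((f_{k-1}, h_{k-1}), (f_k, h_k))`; the zeros are the coefficients of
    -- index `-1`.
    Nat.rec ((0, 0), 1, 0) (fun k s => formalStep a κ θ m₁ m₂ n₁ n₂ n₃ n₄ k s) k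
  let f : ℕ → ℂ := fun k => (S k).2.1
  let h : ℕ → ℂ := fun k => (S k).2.2
  have hh1 : 2 * a * h 1 = m₂ := by
    change 2 * a * ((-(κ * (0 : ℕ) + 2 * θ) * 0 + m₂ * 1 + n₃ * 0 + n₄ * 0) / (2 * a)) = m₂
    field_simp; ring
  have hh : ∀ k, 2 * a * h (k + 2) = -(κ * (k + 1) + 2 * θ) * h (k + 1) + m₂ * f (k + 1) +
      n₃ * f k + n₄ * h k := by
    intro k
    change 2 * a * ((-(κ * (k + 1 : ℕ) + 2 * θ) * h (k + 1) + m₂ * f (k + 1) +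
      n₃ * f k + n₄ * h k) / (2 * a)) = _
    push_cast
    field_simp
  have hf : ∀ k, κ * (k + 1) * f (k + 1) = m₁ * h (k + 1) + n₁ * f k + n₂ * h k := by
    intro k
    have hk : κ * ((k : ℂ) + 1) ≠ 0 := mul_ne_zero hκ (by exact_mod_cast k.succ_ne_zero)
    change κ * (k + 1) * ((m₁ * h (k + 1) + n₁ * f k + n₂ * h k) / (κ * (k + 1))) = _
    rw [mul_div_cancel₀ _ hk]
  have hf0 : f 0 = 1 := rfl
  have hh0 : h 0 = 0 := rfl
  have hX2 : ∀ (φ : ℂ⟦X⟧) (k : ℕ), coeff (k + 2) (X ^ 2 * φ) = coeff k φ := fun φ k =>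
    coeff_X_pow_mul φ 2 k
  have hX20 : ∀ φ : ℂ⟦X⟧, coeff 0 (X ^ 2 * φ) = 0 := fun φ => by
    rw [pow_two, mul_assoc, coeff_zero_X_mul]
  have hX21 : ∀ φ : ℂ⟦X⟧, coeff 1 (X ^ 2 * φ) = 0 := fun φ => by
    rw [pow_two, mul_assoc, show (1 : ℕ) = 0 + 1 from rfl, coeff_succ_X_mul, coeff_zero_X_mul]
  have hX1 : ∀ φ : ℂ⟦X⟧, coeff 1 (X * φ) = coeff 0 φ := fun φ => coeff_succ_X_mul 0 φ
  have hXs : ∀ (φ : ℂ⟦X⟧) (k : ℕ), coeff (k + 2) (X * φ) = coeff (k + 1) φ := fun φ k =>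
    coeff_succ_X_mul (k + 1) φ
  refine ⟨PowerSeries.mk f, PowerSeries.mk h, ?_, ?_, ?_, ?_⟩
  · rw [← coeff_zero_eq_constantCoeff_apply, coeff_mk, hf0]
  · rw [← coeff_zero_eq_constantCoeff_apply, coeff_mk, hh0]
  · ext k
    rcases k with _ | _ | k
    · simp only [map_add, coeff_C_mul, hX20, coeff_zero_X_mul]; simp
    · simp only [map_add, coeff_C_mul, zero_add, hX21, hX1, coeff_mk, hh0]; simp
    · simp only [map_add, coeff_C_mul, hX2, hXs, coeff_mk, PowerSeries.coeff_derivative]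
      linear_combination hf k
  · ext k
    rcases k with _ | _ | k
    · simp only [map_add, coeff_C_mul, hX20, coeff_zero_X_mul, coeff_mk, hh0]; simp
    · simp only [map_add, coeff_C_mul, zero_add, hX21, hX1, coeff_mk, hh0, hf0]
      linear_combination hh1
    · simp only [map_add, coeff_C_mul, hX2, hXs, coeff_mk, PowerSeries.coeff_derivative]
      linear_combination hh k

theorem exists_formal_gauge {a κ : ℂ} (ha : a ≠ 0) (hκ : κ ≠ 0) (θ : ℂ)
    {M₁ : Matrix (Fin 2) (Fin 2) ℂ} (h0 : M₁ 0 0 = θ) (h1 : M₁ 1 1 = -θ)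
    (M₂ : Matrix (Fin 2) (Fin 2) ℂ) :
    ∃ G : Matrix (Fin 2) (Fin 2) ℂ⟦X⟧, G.map constantCoeff = 1 ∧
      (C κ * X ^ 2 : ℂ⟦X⟧) • derivMat G +
        G * (constMat (a • sigma3) + (X : ℂ⟦X⟧) • constMat (θ • sigma3)) =
      (constMat (a • sigma3) + (X : ℂ⟦X⟧) • constMat M₁ + (X ^ 2 : ℂ⟦X⟧) • constMat M₂) * G := by
  obtain ⟨f, h, hf0, hh0, hf, hh⟩ := exists_formal_column ha hκ θ (M₁ 0 1) (M₁ 1 0) (M₂ 0 0)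
    (M₂ 0 1) (M₂ 1 0) (M₂ 1 1)
  -- The second column is the first one with the two indices exchanged, which changes the signs of
  -- `a` and `θ`.
  obtain ⟨f', h', hf0', hh0', hf', hh'⟩ := exists_formal_column (neg_ne_zero.2 ha) hκ (-θ) (M₁ 1 0)
    (M₁ 0 1) (M₂ 1 1) (M₂ 1 0) (M₂ 0 1) (M₂ 0 0)
  simp only [map_mul, map_neg, map_ofNat] at hh hh'
  refine ⟨!![f, h'; h, f'], ?_, ?_⟩
  · ext i j
    fin_cases i <;> fin_cases j <;> simp [hf0, hh0, hf0', hh0']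
  · refine Matrix.ext fun i j => ?_
    simp only [Matrix.add_apply, Matrix.mul_apply, Matrix.smul_apply, constMat, Matrix.map_apply,
      derivMat, smul_eq_mul, Fin.sum_univ_two]
    fin_cases i <;> fin_cases j <;> simp [sigma3, h0, h1]
    · linear_combination hf
    · linear_combination hh'
    · linear_combination hh
    · linear_combination hf'

/-- The trace relations between the coefficients of a rank two irregular singularity and its formal
gauge factor. -/
theorem formal_gauge_traces {a κ θ : ℂ} {M₀ M₁ M₂ : Matrix (Fin 2) (Fin 2) ℂ}
    {G : Matrix (Fin 2) (Fin 2) ℂ⟦X⟧} (hG : IsUnit (G.map constantCoeff))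
    (h : (C κ * X ^ 2 : ℂ⟦X⟧) • derivMat G +
        G * (constMat (a • sigma3) + (X : ℂ⟦X⟧) • constMat (θ • sigma3)) =
      (constMat M₀ + (X : ℂ⟦X⟧) • constMat M₁ + (X ^ 2 : ℂ⟦X⟧) • constMat M₂) * G) :
    M₀.trace = 0 ∧ (M₀ * M₀).trace = 2 * a ^ 2 ∧ M₁.trace = 0 ∧ (M₀ * M₁).trace = 2 * a * θ ∧
      (M₁ * M₁).trace + 2 * (M₀ * M₂).trace = 2 * θ ^ 2 + 2 * κ * a *
        coeff 0 (Matrix.trace (G⁻¹ * derivMat G * constMat sigma3)) := by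
  have hdet : IsUnit G.det := by
    rw [PowerSeries.isUnit_iff_constantCoeff, RingHom.map_det]
    exact (Matrix.isUnit_iff_isUnit_det _).1 hG
  set P := G.map constantCoeff with hP
  set Q := (G⁻¹).map (constantCoeff (R := ℂ)) with hQ
  have hmap : ∀ A B : Matrix (Fin 2) (Fin 2) ℂ⟦X⟧,
      (A * B).map (constantCoeff (R := ℂ)) = A.map constantCoeff * B.map constantCoeff :=
    fun A B => Matrix.map_mul
  have hQP : Q * P = 1 := by
    rw [hQ, hP, ← hmap, Matrix.nonsing_inv_mul _ hdet]
    exact Matrix.map_one _ (map_zero _) (map_one _)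
  have hPQ : P * Q = 1 := mul_eq_one_comm.1 hQP
  set P₁ := G.map (coeff 1) with hP₁
  set P₂ := G.map (coeff 2) with hP₂
  have hexp : ∀ i j, C κ * (X ^ 2 * PowerSeries.derivative ℂ (G i j)) +
      (G i 0 * C ((a • sigma3) 0 j) + G i 1 * C ((a • sigma3) 1 j)) +
      X * (G i 0 * C ((θ • sigma3) 0 j) + G i 1 * C ((θ • sigma3) 1 j)) =
      (C (M₀ i 0) * G 0 j + C (M₀ i 1) * G 1 j) + X * (C (M₁ i 0) * G 0 j + C (M₁ i 1) * G 1 j) +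
      X ^ 2 * (C (M₂ i 0) * G 0 j + C (M₂ i 1) * G 1 j) := by
    intro i j
    have := congrFun (congrFun h i) j
    simp only [Matrix.add_apply, Matrix.mul_apply, Matrix.smul_apply (_ : ℂ⟦X⟧), constMat,
      Matrix.map_apply, derivMat, smul_eq_mul, Fin.sum_univ_two] at this
    linear_combination this
  have hX2 : ∀ φ : ℂ⟦X⟧, coeff 2 (X ^ 2 * φ) = coeff 0 φ := fun φ => coeff_X_pow_mul φ 2 0
  have hX21 : ∀ φ : ℂ⟦X⟧, coeff 1 (X ^ 2 * φ) = 0 := fun φ => by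
    rw [pow_two, mul_assoc, show (1 : ℕ) = 0 + 1 from rfl, coeff_succ_X_mul, coeff_zero_X_mul]
  have hX20 : ∀ φ : ℂ⟦X⟧, coeff 0 (X ^ 2 * φ) = 0 := fun φ => by
    rw [pow_two, mul_assoc, coeff_zero_X_mul]
  have hX1 : ∀ φ : ℂ⟦X⟧, coeff 1 (X * φ) = coeff 0 φ := fun φ => coeff_succ_X_mul 0 φ
  have hX12 : ∀ φ : ℂ⟦X⟧, coeff 2 (X * φ) = coeff 1 φ := fun φ => coeff_succ_X_mul 1 φ
  -- Only the coefficients of order `0, 1, 2` matter. They are conjugated below by `P = G(0)`, which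
  -- makes the leading matrix diagonal without changing traces.
  have e0 : P * (a • sigma3) = M₀ * P := by
    refine Matrix.ext fun i j => ?_
    have := congrArg (coeff 0) (hexp i j)
    simp only [map_add, coeff_C_mul, hX20, coeff_mul_C, coeff_zero_eq_constantCoeff_apply, map_mul,
      constantCoeff_X] at this
    simp only [Matrix.mul_apply, Fin.sum_univ_two, hP, Matrix.map_apply]
    linear_combination this
  have e1 : P₁ * (a • sigma3) + P * (θ • sigma3) = M₀ * P₁ + M₁ * P := by
    refine Matrix.ext fun i j => ?_
    have := congrArg (coeff 1) (hexp i j)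
    simp only [map_add, coeff_C_mul, hX21, hX1, coeff_mul_C,
      coeff_zero_eq_constantCoeff_apply] at this
    simp only [Matrix.add_apply, Matrix.mul_apply, Fin.sum_univ_two, hP, hP₁, Matrix.map_apply]
    linear_combination this
  have e2 : κ • P₁ + P₂ * (a • sigma3) + P₁ * (θ • sigma3) = M₀ * P₂ + M₁ * P₁ + M₂ * P := by
    refine Matrix.ext fun i j => ?_
    have := congrArg (coeff 2) (hexp i j)
    simp only [map_add, coeff_C_mul, hX2, hX12, coeff_mul_C, PowerSeries.coeff_derivative, zero_add,
      Nat.cast_zero, mul_one, coeff_zero_eq_constantCoeff_apply] at this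
    simp only [Matrix.add_apply, Matrix.smul_apply κ, Matrix.mul_apply, Fin.sum_univ_two, hP, hP₁,
      hP₂, Matrix.map_apply, smul_eq_mul κ]
    linear_combination this
  have hJ : coeff 0 (Matrix.trace (G⁻¹ * derivMat G * constMat sigma3)) =
      (Q * P₁) 0 0 - (Q * P₁) 1 1 := by
    have hd : ∀ i j, constantCoeff (derivMat G i j) = P₁ i j := by
      intro i j
      rw [derivMat, Matrix.map_apply, ← coeff_zero_eq_constantCoeff_apply,
        PowerSeries.coeff_derivative]
      simp [hP₁]
    simp only [Matrix.trace_fin_two, Matrix.mul_apply, Fin.sum_univ_two,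
      coeff_zero_eq_constantCoeff_apply, map_add, map_mul, hd, hQ, Matrix.map_apply, constMat,
      constantCoeff_C]
    simp [sigma3]
    ring
  have hM₀ : M₀ = P * (a • sigma3) * Q := by rw [e0, mul_assoc, hPQ, mul_one]
  have hconj : ∀ A B : Matrix (Fin 2) (Fin 2) ℂ,
      (A * B).trace = ((Q * A * P) * (Q * B * P)).trace := by
    intro A B
    rw [show Q * A * P * (Q * B * P) = Q * A * (P * Q) * B * P by simp only [mul_assoc], hPQ,
      mul_one, Matrix.trace_mul_comm (Q * A * B), ← mul_assoc, ← mul_assoc, hPQ, one_mul]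
  have htr : ∀ A : Matrix (Fin 2) (Fin 2) ℂ, A.trace = (Q * A * P).trace := by
    intro A
    rw [Matrix.trace_mul_comm (Q * A), ← mul_assoc, hPQ, one_mul]
  have hN₀ : Q * M₀ * P = a • sigma3 := by
    rw [mul_assoc, ← e0, ← mul_assoc, hQP, one_mul]
  have f1 : Q * P₁ * (a • sigma3) + θ • sigma3 = a • sigma3 * (Q * P₁) + Q * M₁ * P := by
    have := congrArg (Q * ·) e1
    simp only [mul_add, hM₀, ← mul_assoc, hQP, one_mul] at this
    simpa only [mul_assoc] using this
  have f2 : κ • (Q * P₁) + Q * P₂ * (a • sigma3) + Q * P₁ * (θ • sigma3) =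
      a • sigma3 * (Q * P₂) + Q * M₁ * P * (Q * P₁) + Q * M₂ * P := by
    have h1 : Q * M₁ * P * (Q * P₁) = Q * M₁ * P₁ := by
      rw [show Q * M₁ * P * (Q * P₁) = Q * M₁ * (P * Q) * P₁ by simp only [mul_assoc], hPQ, mul_one]
    have := congrArg (Q * ·) e2
    simp only [mul_add, hM₀, ← mul_assoc, hQP, one_mul, mul_smul_comm] at this
    rw [h1]
    simpa only [mul_assoc, mul_smul_comm] using this
  rw [htr M₀, hconj M₀ M₀, htr M₁, hconj M₀ M₁, hconj M₁ M₁, hconj M₀ M₂, hN₀, hJ]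
  generalize Q * P₁ = K at *
  generalize Q * P₂ = L at *
  generalize Q * M₁ * P = N₁ at *
  generalize Q * M₂ * P = N₂ at *
  have g00 := congrFun (congrFun f1 0) 0
  have g01 := congrFun (congrFun f1 0) 1
  have g10 := congrFun (congrFun f1 1) 0
  have g11 := congrFun (congrFun f1 1) 1
  -- On the diagonal the commutator of `σ₃` with the unknown second coefficient `L` vanishes, so
  -- only the entries of `K`, hence the residue, remain.
  have k00 := congrFun (congrFun f2 0) 0
  have k11 := congrFun (congrFun f2 1) 1
  simp only [Matrix.add_apply, Matrix.smul_apply, Matrix.mul_apply, Fin.sum_univ_two, sigma3,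
    Matrix.of_apply, Matrix.cons_val_zero, Matrix.cons_val_one, smul_eq_mul, mul_zero, mul_one,
    zero_mul, add_zero, zero_add, Matrix.cons_val', Matrix.cons_val_fin_one]
    at g00 g01 g10 g11 k00 k11
  have n00 : N₁ 0 0 = θ := by linear_combination -g00
  have n11 : N₁ 1 1 = -θ := by linear_combination -g11
  have n01 : N₁ 0 1 = -(2 * a * K 0 1) := by linear_combination -g01
  have n10 : N₁ 1 0 = 2 * a * K 1 0 := by linear_combination -g10
  rw [n00, n01] at k00
  rw [n10, n11] at k11
  simp only [Matrix.trace_fin_two, Matrix.smul_apply, Matrix.mul_apply, Fin.sum_univ_two, sigma3,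
    Matrix.of_apply, Matrix.cons_val_zero, Matrix.cons_val_one, smul_eq_mul, mul_zero, mul_one,
    zero_mul, add_zero, zero_add, Matrix.cons_val', Matrix.cons_val_fin_one, n00, n01, n10, n11]
  refine ⟨by ring, by ring, by ring, by ring, ?_⟩
  linear_combination 2 * a * (k11 - k00)

end FormalSolutions

/-! ### Consequences of a Lax pair with prescribed exponents -/

section LaxPair

theorem isFormalAtInfinity_iff {ΘI : ℂ} {x : ℝ} {A₁ A₂ : Matrix (Fin 2) (Fin 2) ℂ}
    {G : Matrix (Fin 2) (Fin 2) ℂ⟦X⟧} : IsFormalAtInfinity ΘI x A₁ A₂ G ↔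
      G.map PowerSeries.constantCoeff = 1 ∧
      (PowerSeries.C (-1) * PowerSeries.X ^ 2 : ℂ⟦X⟧) • derivMat G +
        G * (constMat ((I * x / 2) • sigma3) +
          (PowerSeries.X : ℂ⟦X⟧) • constMat (-(ΘI / 2) • sigma3)) =
      (constMat ((I * x / 2) • sigma3) + (PowerSeries.X : ℂ⟦X⟧) • constMat A₁ +
        (PowerSeries.X ^ 2 : ℂ⟦X⟧) • constMat A₂) * G := by
  simp only [IsFormalAtInfinity, map_neg, map_one, neg_one_mul, neg_smul]

theorem isFormalAtZero_iff {Θ₀ : ℂ} {x : ℝ} {A₁ A₂ : Matrix (Fin 2) (Fin 2) ℂ}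
    {G : Matrix (Fin 2) (Fin 2) ℂ⟦X⟧} : IsFormalAtZero Θ₀ x A₁ A₂ G ↔
      IsUnit (G.map PowerSeries.constantCoeff) ∧
      (PowerSeries.C 1 * PowerSeries.X ^ 2 : ℂ⟦X⟧) • derivMat G +
        G * (constMat ((I * x / 2) • sigma3) +
          (PowerSeries.X : ℂ⟦X⟧) • constMat ((Θ₀ / 2) • sigma3)) =
      (constMat A₂ + (PowerSeries.X : ℂ⟦X⟧) • constMat A₁ +
        (PowerSeries.X ^ 2 : ℂ⟦X⟧) • constMat ((I * x / 2) • sigma3)) * G := by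
  rw [IsFormalAtZero, map_one, one_mul, add_comm (constMat A₂),
    add_comm (_ + constMat A₂) (PowerSeries.X ^ 2 • _), ← add_assoc]

theorem constMat_smul (a : ℂ) (M : Matrix (Fin 2) (Fin 2) ℂ) :
    constMat (a • M) = PowerSeries.C a • constMat M := by
  ext i j : 2
  simp [constMat]

theorem jmuZero_eq (G : Matrix (Fin 2) (Fin 2) ℂ⟦X⟧) : jmuZero G = I / 2 *
    PowerSeries.coeff 0 (Matrix.trace (G⁻¹ * derivMat G * constMat sigma3)) := by
  rw [jmuZero, constMat_smul, mul_smul_comm, Matrix.trace_smul, smul_eq_mul,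
    PowerSeries.coeff_C_mul]
  ring

theorem jmuInfinity_eq (G : Matrix (Fin 2) (Fin 2) ℂ⟦X⟧) : jmuInfinity G = -(I / 2) *
    PowerSeries.coeff 0 (Matrix.trace (G⁻¹ * derivMat G * constMat sigma3)) := by
  have hX : ∀ φ : ℂ⟦X⟧, PowerSeries.coeff 1 (PowerSeries.X * φ) = PowerSeries.coeff 0 φ :=
    fun φ => PowerSeries.coeff_succ_X_mul 0 φ
  rw [jmuInfinity, constMat_smul, mul_smul_comm, Matrix.trace_smul, smul_eq_mul,
    PowerSeries.coeff_C_mul, mul_neg, mul_smul_comm, neg_mul, smul_mul_assoc, Matrix.trace_neg,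
    Matrix.trace_smul, smul_eq_mul, map_neg, hX]
  ring

/-- The algebraic relations for the coefficients of the Lax matrix imposed by the formal monodromy
exponents, and the resulting value of the logarithmic derivative of the τ-function. -/
theorem formal_relations {Θ₀ ΘI : ℂ} {x : ℝ} {A₁ A₂ : Matrix (Fin 2) (Fin 2) ℂ}
    {G₀ GI : Matrix (Fin 2) (Fin 2) ℂ⟦X⟧} (hx : x ≠ 0) (h0 : IsFormalAtZero Θ₀ x A₁ A₂ G₀)
    (hI : IsFormalAtInfinity ΘI x A₁ A₂ GI) :
    A₂ 1 1 = -A₂ 0 0 ∧ A₂ 0 0 ^ 2 + A₂ 0 1 * A₂ 1 0 = -(x : ℂ) ^ 2 / 4 ∧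
      A₁ 0 0 = -(ΘI / 2) ∧ A₁ 1 1 = ΘI / 2 ∧
      A₁ 0 1 * A₂ 1 0 + A₁ 1 0 * A₂ 0 1 = I * x * Θ₀ / 2 + ΘI * A₂ 0 0 ∧
      x * (jmuZero G₀ + jmuInfinity GI) =
        2 * A₁ 0 1 * A₁ 1 0 + 2 * I * x * A₂ 0 0 + (ΘI ^ 2 - Θ₀ ^ 2) / 4 := by
  have hx' : (x : ℂ) ≠ 0 := by exact_mod_cast hx
  obtain ⟨hu0, h0⟩ := isFormalAtZero_iff.1 h0
  obtain ⟨hu1, hI⟩ := isFormalAtInfinity_iff.1 hI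
  obtain ⟨t1, t2, t3, t4, t5⟩ := formal_gauge_traces hu0 h0
  obtain ⟨-, -, -, s4, s5⟩ := formal_gauge_traces (hu1 ▸ isUnit_one) hI
  rw [jmuZero_eq, jmuInfinity_eq]
  generalize PowerSeries.coeff 0 (Matrix.trace (G₀⁻¹ * derivMat G₀ * constMat sigma3)) = J₀ at *
  generalize PowerSeries.coeff 0 (Matrix.trace (GI⁻¹ * derivMat GI * constMat sigma3)) = J₁ at *
  simp only [Matrix.trace_fin_two, Matrix.mul_apply, Fin.sum_univ_two, Matrix.smul_apply, sigma3,
    Matrix.of_apply, Matrix.cons_val_zero, Matrix.cons_val_one, smul_eq_mul, mul_zero, mul_one,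
    zero_mul, add_zero, zero_add, Matrix.cons_val', Matrix.cons_val_fin_one] at t1 t2 t3 t4 t5 s4 s5
  have r1 : A₂ 1 1 = -A₂ 0 0 := by linear_combination t1
  have r3 : A₁ 1 1 = -A₁ 0 0 := by linear_combination t3
  have hIx : I * (x : ℂ) ≠ 0 := mul_ne_zero I_ne_zero hx'
  have r4 : A₁ 0 0 = -(ΘI / 2) := by
    refine mul_left_cancel₀ hIx ?_
    rw [r3] at s4
    linear_combination s4
  rw [r1] at t2 t4 t5 s5
  rw [r3, r4] at t4 t5 s5
  refine ⟨r1, ?_, r4, by rw [r3, r4, neg_neg], ?_, ?_⟩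
  · linear_combination t2 / 2 + (x : ℂ) ^ 2 / 4 * I_sq
  · linear_combination t4
  -- `t5` and `s5` evaluate the same quantity, the `λ⁻²` coefficient of `tr A²`, with `κ = 1` at `0`
  -- and `κ = -1` at `∞`.
  · linear_combination -(t5 + s5) / 2

/-- The expansion of the commutator `A B - B A` in powers of `λ`. -/
theorem laxA_laxB_commutator (x : ℝ) (A₁ A₂ B₀ B₁ : Matrix (Fin 2) (Fin 2) ℂ) {l : ℂ} (hl : l ≠ 0)
    (i j : Fin 2) :
    (laxA x A₁ A₂ l * laxB B₀ B₁ l - laxB B₀ B₁ l * laxA x A₁ A₂ l) i j =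
      ((I * x / 2) • (sigma3 * B₀ - B₀ * sigma3) + (I / 2) • (A₁ * sigma3 - sigma3 * A₁)) i j +
      1 / l * ((I * x / 2) • (sigma3 * B₁ - B₁ * sigma3) + (A₁ * B₀ - B₀ * A₁) +
        (I / 2) • (A₂ * sigma3 - sigma3 * A₂)) i j +
      1 / l ^ 2 * ((A₁ * B₁ - B₁ * A₁) + (A₂ * B₀ - B₀ * A₂)) i j +
      1 / l ^ 3 * (A₂ * B₁ - B₁ * A₂) i j := by
  simp only [laxA, laxB, Matrix.sub_apply, Matrix.add_apply, Matrix.mul_apply, Fin.sum_univ_two,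
    Matrix.smul_apply, smul_eq_mul]
  fin_cases i <;> fin_cases j <;> (simp [sigma3]; field_simp; ring)

theorem hasDerivAt_laxB (B₀ B₁ : Matrix (Fin 2) (Fin 2) ℂ) {l : ℂ} (hl : l ≠ 0) (i j : Fin 2) :
    HasDerivAt (fun l => laxB B₀ B₁ l i j) (I / 2 * sigma3 i j - 1 / l ^ 2 * B₁ i j) l := by
  have h1 : HasDerivAt (fun l : ℂ => I * l / 2) (I / 2) l := by
    simpa using ((hasDerivAt_id l).const_mul I).div_const 2
  have h2 : HasDerivAt (fun l : ℂ => 1 / l) (-(1 / l ^ 2)) l := by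
    simpa [one_div] using hasDerivAt_inv hl
  have h := ((h1.mul_const (sigma3 i j)).add_const (B₀ i j)).add (h2.mul_const (B₁ i j))
  rw [neg_mul, ← sub_eq_add_neg] at h
  exact h

/-- Four values, at `±1` and `±2`, already determine a cubic in `1/λ`. -/
theorem coeffs_eq_zero_of_forall {c₀ c₁ c₂ c₃ : ℂ}
    (h : ∀ l : ℂ, l ≠ 0 → c₀ + 1 / l * c₁ + 1 / l ^ 2 * c₂ + 1 / l ^ 3 * c₃ = 0) :
    c₀ = 0 ∧ c₁ = 0 ∧ c₂ = 0 ∧ c₃ = 0 := by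
  have h1 := h 1 one_ne_zero
  have h2 := h (-1) (by norm_num)
  have h3 := h 2 (by norm_num)
  have h4 := h (-2) (by norm_num)
  norm_num at h1 h2 h3 h4
  refine ⟨?_, ?_, ?_, ?_⟩
  · linear_combination -1 / 6 * h1 - 1 / 6 * h2 + 2 / 3 * h3 + 2 / 3 * h4
  · linear_combination -1 / 6 * h1 + 1 / 6 * h2 + 4 / 3 * h3 - 4 / 3 * h4
  · linear_combination 2 / 3 * h1 + 2 / 3 * h2 - 2 / 3 * h3 - 2 / 3 * h4
  · linear_combination 2 / 3 * h1 - 2 / 3 * h2 - 4 / 3 * h3 + 4 / 3 * h4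

theorem hasDerivAt_mul_ofReal_div_two (c : ℂ) (x : ℝ) :
    HasDerivAt (fun x : ℝ => I * (x : ℂ) / 2 * c) (I / 2 * c) x := by
  simpa using (((hasDerivAt_id x).ofReal_comp.const_mul I).div_const 2).mul_const c

/-- The zero-curvature equation at a point, coefficient by coefficient in `λ`. -/
theorem zero_curvature_iff {x : ℝ} {A₁ A₂ : ℝ → Matrix (Fin 2) (Fin 2) ℂ}
    {B₀ B₁ : Matrix (Fin 2) (Fin 2) ℂ} :
    (∀ l : ℂ, l ≠ 0 → ∀ i j : Fin 2, HasDerivAt (fun x' => laxA x' (A₁ x') (A₂ x') l i j)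
      (deriv (fun l' => laxB B₀ B₁ l' i j) l -
        (laxA x (A₁ x) (A₂ x) l * laxB B₀ B₁ l - laxB B₀ B₁ l * laxA x (A₁ x) (A₂ x) l) i j) x) ↔
    ∀ i j,
      ((I * x / 2) • (sigma3 * B₀ - B₀ * sigma3) +
        (I / 2) • (A₁ x * sigma3 - sigma3 * A₁ x)) i j = 0 ∧
      HasDerivAt (fun x' => A₁ x' i j) (-((I * x / 2) • (sigma3 * B₁ - B₁ * sigma3) +
        (A₁ x * B₀ - B₀ * A₁ x) + (I / 2) • (A₂ x * sigma3 - sigma3 * A₂ x)) i j) x ∧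
      HasDerivAt (fun x' => A₂ x' i j) (-(B₁ i j + ((A₁ x * B₁ - B₁ * A₁ x) +
        (A₂ x * B₀ - B₀ * A₂ x)) i j)) x ∧
      (A₂ x * B₁ - B₁ * A₂ x) i j = 0 := by
  have hexp : ∀ (l : ℂ) (i j : Fin 2) (x' : ℝ), laxA x' (A₁ x') (A₂ x') l i j =
      I * x' / 2 * sigma3 i j + 1 / l * A₁ x' i j + 1 / l ^ 2 * A₂ x' i j := fun l i j x' => rfl
  constructor
  · intro h i j
    -- Only `A(λ)` is known to be differentiable in `x`; the part of it odd in `λ` isolates `A₁`.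
    have hd₁ : DifferentiableAt ℝ (fun x' => A₁ x' i j) x := by
      have h1 := ((h 1 one_ne_zero i j).sub (h (-1) (by norm_num) i j)).differentiableAt.const_mul
        (1 / 2 : ℂ)
      refine h1.congr_of_eventuallyEq (Eventually.of_forall fun x' => ?_)
      simp only [Pi.sub_apply, hexp]
      ring
    have hd₂ : DifferentiableAt ℝ (fun x' => A₂ x' i j) x := by
      have h1 := (((h 1 one_ne_zero i j).differentiableAt.sub
        (hasDerivAt_mul_ofReal_div_two (sigma3 i j) x).differentiableAt).sub hd₁)
      refine h1.congr_of_eventuallyEq (Eventually.of_forall fun x' => ?_)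
      simp only [Pi.sub_apply, hexp]
      ring
    have hl : ∀ l : ℂ, l ≠ 0 → 
        ((I * x / 2) • (sigma3 * B₀ - B₀ * sigma3) +
          (I / 2) • (A₁ x * sigma3 - sigma3 * A₁ x)) i j +
        1 / l * (deriv (fun x' => A₁ x' i j) x + ((I * x / 2) • (sigma3 * B₁ - B₁ * sigma3) +
          (A₁ x * B₀ - B₀ * A₁ x) + (I / 2) • (A₂ x * sigma3 - sigma3 * A₂ x)) i j) +
        1 / l ^ 2 * (deriv (fun x' => A₂ x' i j) x + (B₁ i j + ((A₁ x * B₁ - B₁ * A₁ x) +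
          (A₂ x * B₀ - B₀ * A₂ x)) i j)) + 1 / l ^ 3 * (A₂ x * B₁ - B₁ * A₂ x) i j = 0 := by
      intro l hl
      have h1 := ((hasDerivAt_mul_ofReal_div_two (sigma3 i j) x).add
        (hd₁.hasDerivAt.const_mul (1 / l))).add (hd₂.hasDerivAt.const_mul (1 / l ^ 2))
      have h2 := h1.unique (h l hl i j)
      rw [(hasDerivAt_laxB B₀ B₁ hl i j).deriv, laxA_laxB_commutator x _ _ _ _ hl] at h2
      linear_combination h2
    obtain ⟨c0, c1, c2, c3⟩ := coeffs_eq_zero_of_forall hl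
    refine ⟨c0, ?_, ?_, c3⟩
    · rw [← eq_neg_of_add_eq_zero_left c1]; exact hd₁.hasDerivAt
    · rw [← eq_neg_of_add_eq_zero_left c2]; exact hd₂.hasDerivAt
  · intro h l hl i j
    obtain ⟨c0, h1, h2, c3⟩ := h i j
    have h3 := ((hasDerivAt_mul_ofReal_div_two (sigma3 i j) x).add
        (h1.const_mul (1 / l))).add (h2.const_mul (1 / l ^ 2))
    refine HasDerivAt.congr_deriv (f := fun x' => laxA x' (A₁ x') (A₂ x') l i j) h3 ?_
    rw [(hasDerivAt_laxB B₀ B₁ hl i j).deriv, laxA_laxB_commutator x _ _ _ _ hl, c0, c3]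
    ring

/-- For a Lax pair with prescribed formal monodromy exponents, `y` satisfies a Riccati equation
whose coefficient is a diagonal entry of the Lax matrix. -/
theorem IsLaxPair.hasDerivAt {Θ₀ ΘI : ℂ} {y : ℝ → ℂ} {U : Set ℝ}
    {A₁ A₂ B₀ B₁ : ℝ → Matrix (Fin 2) (Fin 2) ℂ} (h : IsLaxPair y U A₁ A₂ B₀ B₁) (hU : IsOpen U)
    (hU0 : ∀ x ∈ U, x ≠ 0)
    (hG : ∀ x ∈ U, ∃ G₀ GI : Matrix (Fin 2) (Fin 2) ℂ⟦X⟧,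
      IsFormalAtZero Θ₀ x (A₁ x) (A₂ x) G₀ ∧ IsFormalAtInfinity ΘI x (A₁ x) (A₂ x) GI)
    {x : ℝ} (hx : x ∈ U) :
    HasDerivAt y (2 + (2 * ΘI - 1) * y x / x + 4 * I * A₂ x 0 0 * y x ^ 2 / x) x ∧
      ContinuousAt (fun x => A₂ x 0 0) x := by
  have hrel : ∀ x ∈ U, A₂ x 1 1 = -A₂ x 0 0 ∧
      A₂ x 0 0 ^ 2 + A₂ x 0 1 * A₂ x 1 0 = -(x : ℂ) ^ 2 / 4 ∧
      A₁ x 0 0 = -(ΘI / 2) ∧ A₁ x 1 1 = ΘI / 2 := by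
    intro x hx
    obtain ⟨G₀, GI, h0, hI⟩ := hG x hx
    obtain ⟨r1, r2, r3, r4, -⟩ := formal_relations (hU0 x hx) h0 hI
    exact ⟨r1, r2, r3, r4⟩
  obtain ⟨r1, r2, r3, r4⟩ := hrel x hx
  have hzc := zero_curvature_iff.1 (h.1 x hx)
  obtain ⟨hq, hy⟩ := h.2 x hx
  have hx' : (x : ℂ) ≠ 0 := by exact_mod_cast hU0 x hx
  obtain ⟨a01, b01, d01, e01⟩ := hzc 0 1
  obtain ⟨-, -, d00, e00⟩ := hzc 0 0
  obtain ⟨-, -, d10, -⟩ := hzc 1 0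
  obtain ⟨-, -, d11, -⟩ := hzc 1 1
  refine ⟨?_, d00.continuousAt⟩
  have hdet : HasDerivAt (fun x : ℝ => -(x : ℂ) ^ 2 / 4) (-(x : ℂ) / 2) x := by
    refine (((hasDerivAt_id x).ofReal_comp.pow 2).neg.div_const 4).congr_deriv ?_
    simp; ring
  have hdet' := ((d00.pow 2).add (d01.mul d10)).unique (hdet.congr_of_eventuallyEq (by
    filter_upwards [hU.mem_nhds hx] with z hz using (hrel z hz).2.1))
  have htr' := d11.unique (d00.neg.congr_of_eventuallyEq (by
    filter_upwards [hU.mem_nhds hx] with z hz using (hrel z hz).1))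
  have hyev : y =ᶠ[𝓝 x] fun x => -I * (A₁ x 0 1 / A₂ x 0 1) := by
    filter_upwards [hU.mem_nhds hx] with z hz using (h.2 z hz).2
  refine (((b01.div d01 hq).const_mul (-I)).congr_of_eventuallyEq hyev).congr_deriv ?_
  rw [hy]
  simp only [Matrix.sub_apply, Matrix.add_apply, Matrix.mul_apply, Fin.sum_univ_two,
    Matrix.smul_apply, smul_eq_mul, sigma3, Matrix.of_apply, Matrix.cons_val_zero,
    Matrix.cons_val_one, mul_zero, zero_mul, add_zero, zero_add, Matrix.cons_val',
    Matrix.cons_val_fin_one, one_mul, r1, r3, r4] at a01 e01 e00 hdet' htr' ⊢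
  generalize A₂ x 0 0 = p at *
  generalize A₂ x 0 1 = q at *
  generalize A₂ x 1 0 = r at *
  generalize A₁ x 0 1 = b at *
  generalize A₁ x 1 0 = c at *
  generalize B₀ x 0 0 = β₀ at *
  generalize B₀ x 0 1 = β₁ at *
  generalize B₀ x 1 0 = β₂ at *
  generalize B₀ x 1 1 = β₃ at *
  generalize B₁ x 0 0 = γ₀ at *
  generalize B₁ x 0 1 = γ₁ at *
  generalize B₁ x 1 0 = γ₂ at *
  generalize B₁ x 1 1 = γ₃ at *
  -- As `A₂` commutes with `B₁` and `q ≠ 0`, the matrix `B₁` is `αA₂` plus a scalar; the scalar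
  -- vanishes because `tr A₂ = 0` is preserved.
  obtain ⟨α, rfl⟩ : ∃ α, γ₁ = α * q := ⟨γ₁ / q, by field_simp⟩
  have g2 : γ₂ = α * r := by
    refine mul_left_cancel₀ hq ?_
    linear_combination e00
  have g0 : γ₀ = γ₃ + 2 * p * α := by
    refine mul_left_cancel₀ hq ?_
    linear_combination -e01
  have g3 : γ₃ = -(p * α) := by
    subst g0 g2
    linear_combination -htr' / 2
  have hβ : β₁ = b / x := by
    rw [eq_div_iff hx']
    refine mul_left_cancel₀ I_ne_zero ?_
    linear_combination a01
  subst g0 g2 g3 hβ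
  -- Differentiating `p² + qr = -x²/4` along the flow gives `-x/2 = αx²/2`.
  have hα : α = -1 / x := by
    rw [eq_div_iff hx']
    refine mul_left_cancel₀ hx' ?_
    linear_combination 2 * hdet' + 4 * α * r2
  subst hα
  field_simp
  ring_nf
  simp only [I_pow_three, I_sq]
  ring

end LaxPair

/-! ### Construction of the Lax pair from the first-order system -/

section LaxConstruction

theorem exists_isFormalAtInfinity {ΘI : ℂ} {x : ℝ} {A₁ : Matrix (Fin 2) (Fin 2) ℂ} (hx : x ≠ 0)
    (h0 : A₁ 0 0 = -(ΘI / 2)) (h1 : A₁ 1 1 = ΘI / 2) (A₂ : Matrix (Fin 2) (Fin 2) ℂ) :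
    ∃ G, IsFormalAtInfinity ΘI x A₁ A₂ G := by
  have ha : I * (x : ℂ) / 2 ≠ 0 :=
    div_ne_zero (mul_ne_zero I_ne_zero (by exact_mod_cast hx)) two_ne_zero
  obtain ⟨G, hG⟩ := exists_formal_gauge ha (neg_ne_zero.2 one_ne_zero) (-(ΘI / 2)) h0
    (by rw [h1, neg_neg]) A₂
  exact ⟨G, isFormalAtInfinity_iff.2 hG⟩

theorem constMat_mul (M N : Matrix (Fin 2) (Fin 2) ℂ) :
    constMat (M * N) = constMat M * constMat N :=
  Matrix.map_mul

theorem derivMat_constMat_mul (M : Matrix (Fin 2) (Fin 2) ℂ) (G : Matrix (Fin 2) (Fin 2) ℂ⟦X⟧) :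
    derivMat (constMat M * G) = constMat M * derivMat G := by
  ext i j k
  simp only [derivMat, constMat, Matrix.map_apply, Matrix.mul_apply, map_sum,
    PowerSeries.coeff_derivative, PowerSeries.coeff_C_mul, mul_assoc]

/-- Diagonalize `A₂`, whose eigenvalues are `±ix/2`, and apply `exists_formal_gauge`; `hmix` says
exactly that the conjugated `A₁` has diagonal `±Θ₀/2`. -/
theorem exists_isFormalAtZero {Θ₀ : ℂ} {x : ℝ} {A₁ A₂ : Matrix (Fin 2) (Fin 2) ℂ} (hx : x ≠ 0)
    (h01 : A₂ 0 1 = 1) (htr : A₂ 1 1 = -A₂ 0 0) (hdet : A₂ 0 0 ^ 2 + A₂ 1 0 = -(x : ℂ) ^ 2 / 4)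
    (htr₁ : A₁ 1 1 = -A₁ 0 0)
    (hmix : A₁ 0 1 * A₂ 1 0 + A₁ 1 0 + 2 * A₁ 0 0 * A₂ 0 0 = I * x * Θ₀ / 2) :
    ∃ G, IsFormalAtZero Θ₀ x A₁ A₂ G := by
  have hx' : (x : ℂ) ≠ 0 := by exact_mod_cast hx
  obtain ⟨a, ha_def⟩ : ∃ a, a = I * (x : ℂ) / 2 := ⟨_, rfl⟩
  have ha : a ≠ 0 := ha_def ▸ div_ne_zero (mul_ne_zero I_ne_zero hx') two_ne_zero
  have ha2 : A₂ 1 0 = a ^ 2 - A₂ 0 0 ^ 2 := by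
    rw [ha_def]; linear_combination hdet - (x : ℂ) ^ 2 / 4 * I_sq
  have hmix' : A₁ 0 1 * (a ^ 2 - A₂ 0 0 ^ 2) + A₁ 1 0 + 2 * A₁ 0 0 * A₂ 0 0 = a * Θ₀ := by
    rw [← ha2, hmix, ha_def]; ring
  -- The columns are eigenvectors of `A₂` for `a` and `-a`.
  let P : Matrix (Fin 2) (Fin 2) ℂ := !![1, 1; a - A₂ 0 0, -a - A₂ 0 0]
  let Q : Matrix (Fin 2) (Fin 2) ℂ :=
    !![(a + A₂ 0 0) / (2 * a), 1 / (2 * a); (a - A₂ 0 0) / (2 * a), -1 / (2 * a)]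
  have hPQ : P * Q = 1 := by
    ext i j
    fin_cases i <;> fin_cases j <;>
    · simp [P, Q, Matrix.mul_apply, Fin.sum_univ_two]
      field_simp
      ring
  have hN0 : (Q * A₁ * P) 0 0 = Θ₀ / 2 := by
    simp only [P, Q, htr₁, Matrix.mul_apply, Fin.sum_univ_two, Matrix.of_apply,
      Matrix.cons_val_zero, Matrix.cons_val_one, Matrix.cons_val', Matrix.cons_val_fin_one]
    field_simp
    linear_combination hmix'
  have hN1 : (Q * A₁ * P) 1 1 = -(Θ₀ / 2) := by
    simp only [P, Q, htr₁, Matrix.mul_apply, Fin.sum_univ_two, Matrix.of_apply,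
      Matrix.cons_val_zero, Matrix.cons_val_one, Matrix.cons_val', Matrix.cons_val_fin_one]
    field_simp
    linear_combination -hmix'
  have hP₂ : P * (a • sigma3) = A₂ * P := by
    ext i j
    fin_cases i <;> fin_cases j <;>
    · simp [P, sigma3, Matrix.mul_apply, Fin.sum_univ_two, h01, htr, ha2]
      try ring
  obtain ⟨G, hG0, hG⟩ := exists_formal_gauge ha one_ne_zero (Θ₀ / 2) hN0 hN1 (Q * (a • sigma3) * P)
  refine ⟨constMat P * G, isFormalAtZero_iff.2 (ha_def ▸ ⟨?_, ?_⟩)⟩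
  · have h1 : (constMat P * G).map (PowerSeries.constantCoeff (R := ℂ)) = P := by
      rw [Matrix.map_mul, hG0, mul_one]
      ext i j
      simp [constMat]
    rw [h1]
    exact IsUnit.of_mul_eq_one Q hPQ
  · have h1 : constMat P * constMat (Q * A₁ * P) = constMat A₁ * constMat P := by
      rw [← constMat_mul, ← constMat_mul, ← mul_assoc, ← mul_assoc, hPQ, one_mul]
    have h2 : constMat P * constMat (Q * (a • sigma3) * P) =
        constMat (a • sigma3) * constMat P := by
      rw [← constMat_mul, ← constMat_mul, ← mul_assoc, ← mul_assoc, hPQ, one_mul]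
    have h3 : constMat P * constMat (a • sigma3) = constMat A₂ * constMat P := by
      rw [← constMat_mul, ← constMat_mul, hP₂]
    rw [derivMat_constMat_mul, mul_assoc (constMat P), ← mul_smul_comm, ← mul_add, hG,
      ← mul_assoc, mul_add, mul_add, mul_smul_comm, mul_smul_comm, h1, h2, h3, ← mul_assoc]
    simp only [add_mul, smul_mul_assoc]

/-- The diagonal entry of the leading coefficient at `λ = 0`. -/
noncomputable def laxDiag (x : ℝ) (s : ℂ) : ℂ := -(I * x / 2) * (1 - 2 * s)

/-- The coefficient of `λ⁻²` of the Lax matrix in the gauge with off-diagonal entry `1`. -/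
noncomputable def laxTwo (x : ℝ) (s : ℂ) : Matrix (Fin 2) (Fin 2) ℂ :=
  !![laxDiag x s, 1; -(x : ℂ) ^ 2 * (s * (1 - s)), -laxDiag x s]

/-- The coefficient of `λ⁻¹` of the Lax matrix. -/
noncomputable def laxOne (Θ₀ ΘI : ℂ) (x : ℝ) (y s : ℂ) : Matrix (Fin 2) (Fin 2) ℂ :=
  !![-(ΘI / 2), I * y;
    I * x * Θ₀ / 2 + ΘI * laxDiag x s + I * y * ((x : ℂ) ^ 2 * (s * (1 - s))), ΘI / 2]

/-- The coefficient of `λ⁰` of the deformation matrix. -/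
noncomputable def deformationZero (Θ₀ ΘI : ℂ) (x : ℝ) (y s : ℂ) : Matrix (Fin 2) (Fin 2) ℂ :=
  !![-((1 - ΘI) / x - 4 * I * laxDiag x s * y / x) / 2, I * y / x;
    laxOne Θ₀ ΘI x y s 1 0 / x, ((1 - ΘI) / x - 4 * I * laxDiag x s * y / x) / 2]

/-- The coefficient of `λ⁻¹` of the deformation matrix. -/
noncomputable def deformationOne (x : ℝ) (s : ℂ) : Matrix (Fin 2) (Fin 2) ℂ :=
  (-1 / (x : ℂ)) • laxTwo x s

theorem exists_formal_lax {x : ℝ} (hx : x ≠ 0) (Θ₀ ΘI y s : ℂ) :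
    ∃ G₀ GI, IsFormalAtZero Θ₀ x (laxOne Θ₀ ΘI x y s) (laxTwo x s) G₀ ∧
      IsFormalAtInfinity ΘI x (laxOne Θ₀ ΘI x y s) (laxTwo x s) GI := by
  obtain ⟨GI, hI⟩ := exists_isFormalAtInfinity (ΘI := ΘI) (A₁ := laxOne Θ₀ ΘI x y s) hx rfl rfl
    (laxTwo x s)
  have hdet : laxTwo x s 0 0 ^ 2 + laxTwo x s 1 0 = -(x : ℂ) ^ 2 / 4 := by
    change (-(I * (x : ℂ) / 2) * (1 - 2 * s)) ^ 2 + -(x : ℂ) ^ 2 * (s * (1 - s)) = _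
    linear_combination (x : ℂ) ^ 2 / 4 * (1 - 2 * s) ^ 2 * I_sq
  have hmix : laxOne Θ₀ ΘI x y s 0 1 * laxTwo x s 1 0 + laxOne Θ₀ ΘI x y s 1 0 +
      2 * laxOne Θ₀ ΘI x y s 0 0 * laxTwo x s 0 0 = I * x * Θ₀ / 2 := by
    change I * y * (-(x : ℂ) ^ 2 * (s * (1 - s))) + (I * x * Θ₀ / 2 + ΘI * laxDiag x s +
      I * y * ((x : ℂ) ^ 2 * (s * (1 - s)))) + 2 * -(ΘI / 2) * laxDiag x s = _
    ring
  obtain ⟨G₀, h0⟩ := exists_isFormalAtZero (Θ₀ := Θ₀) (A₁ := laxOne Θ₀ ΘI x y s)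
    (A₂ := laxTwo x s) hx rfl rfl hdet (neg_neg (ΘI / 2)).symm hmix
  exact ⟨G₀, GI, h0, hI⟩

/-- The gauge `(A₂)₁₂ = 1` makes `(A₁)₁₂ = iy`. The deformation matrices are those that zero
curvature dictates: `B₁ = -A₂/x`, the off-diagonal part of `B₀` is that of `A₁` over `x`, and its
diagonal keeps `(A₂)₁₂` constant. -/
theorem isLaxPair_of_system {Θ₀ ΘI : ℂ} {y s : ℝ → ℂ} {U : Set ℝ} (hU : ∀ x ∈ U, x ≠ 0)
    (hy : ∀ x ∈ U, HasDerivAt y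
      (2 + (2 * ΘI - 1) * y x / x + (2 - 4 * s x) * y x ^ 2) x)
    (hs : ∀ x ∈ U, HasDerivAt s
      ((-(2 * ΘI * s x) + (ΘI - Θ₀)) / x - 4 * y x * s x * (1 - s x)) x) :
    IsLaxPair y U (fun x => laxOne Θ₀ ΘI x (y x) (s x)) (fun x => laxTwo x (s x))
      (fun x => deformationZero Θ₀ ΘI x (y x) (s x)) (fun x => deformationOne x (s x)) := by
  refine ⟨fun x hx => zero_curvature_iff.2 ?_, fun x hx => ⟨one_ne_zero, ?_⟩⟩
  · have hx' : (x : ℂ) ≠ 0 := by exact_mod_cast hU x hx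
    have dx : HasDerivAt (fun x : ℝ => (x : ℂ)) 1 x := (hasDerivAt_id x).ofReal_comp
    have dp := ((dx.const_mul I).div_const 2).neg.mul (((hs x hx).const_mul 2).const_sub 1)
    have dr := (dx.pow 2).neg.mul ((hs x hx).mul ((hs x hx).const_sub 1))
    have db := (hy x hx).const_mul I
    have dc := ((((dx.const_mul I).mul_const Θ₀).div_const 2).add (dp.const_mul ΘI)).add
      (db.mul ((dx.pow 2).mul ((hs x hx).mul ((hs x hx).const_sub 1))))
    intro i j
    refine ⟨?_, ?_, ?_, ?_⟩
    · fin_cases i <;> fin_cases j <;>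
      · simp [deformationZero, laxOne, sigma3]
        try field_simp
        try ring
    · fin_cases i <;> fin_cases j
      · refine (hasDerivAt_const x (-(ΘI / 2))).congr_deriv ?_
        simp [laxOne, laxTwo, deformationZero, deformationOne, laxDiag, sigma3]
        ring_nf
      · refine HasDerivAt.congr_deriv (f := fun x => laxOne Θ₀ ΘI x (y x) (s x) 0 1) db ?_
        simp [laxOne, laxTwo, deformationZero, deformationOne, laxDiag, sigma3]
        field_simp
        simp only [I_sq]
        ring
      · refine HasDerivAt.congr_deriv (f := fun x => laxOne Θ₀ ΘI x (y x) (s x) 1 0) dc ?_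
        simp [laxOne, laxTwo, deformationZero, deformationOne, laxDiag, sigma3]
        field_simp
        simp only [I_sq]
        ring
      · refine (hasDerivAt_const x (ΘI / 2)).congr_deriv ?_
        simp [laxOne, laxTwo, deformationZero, deformationOne, laxDiag, sigma3]
        ring_nf
    · fin_cases i <;> fin_cases j
      · refine HasDerivAt.congr_deriv (f := fun x => laxTwo x (s x) 0 0) dp ?_
        simp [laxOne, laxTwo, deformationZero, deformationOne, laxDiag]
        field_simp
        ring_nf
      · refine (hasDerivAt_const x (1 : ℂ)).congr_deriv ?_
        simp [laxOne, laxTwo, deformationZero, deformationOne, laxDiag]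
        ring_nf
      · refine HasDerivAt.congr_deriv (f := fun x => laxTwo x (s x) 1 0) dr ?_
        simp [laxOne, laxTwo, deformationZero, deformationOne, laxDiag]
        field_simp
        simp only [I_sq]
        ring
      · refine HasDerivAt.congr_deriv (f := fun x => laxTwo x (s x) 1 1) dp.neg ?_
        simp [laxOne, laxTwo, deformationZero, deformationOne, laxDiag]
        field_simp
        ring_nf
    · fin_cases i <;> fin_cases j <;>
      · simp [deformationOne, laxTwo]
        ring
  · simp only [laxOne, laxTwo, Matrix.of_apply, Matrix.cons_val_zero, Matrix.cons_val_one,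
      Matrix.cons_val', Matrix.cons_val_fin_one, div_one]
    linear_combination y x * I_sq
end LaxConstruction

/-! ### Identification and uniqueness of the τ-function -/

section TauFunction

/-- The Hamiltonian of the third Painlevé equation, up to the factor `1 / x`. -/
noncomputable def jmuHamiltonian (Θ₀ ΘI : ℂ) (x : ℝ) (y p : ℂ) : ℂ :=
  2 * I * y * (I * x * Θ₀ / 2 + ΘI * p) - 2 * y ^ 2 * ((x : ℂ) ^ 2 / 4 + p ^ 2) + 2 * I * x * p +
    (ΘI ^ 2 - Θ₀ ^ 2) / 4

/-- The relations at the two singular points eliminate the remaining matrix entries, so the residue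
sum does not depend on the diagonal gauge. -/
theorem mul_jmu_eq {Θ₀ ΘI y : ℂ} {x : ℝ} {A₁ A₂ : Matrix (Fin 2) (Fin 2) ℂ}
    {G₀ GI : Matrix (Fin 2) (Fin 2) ℂ⟦X⟧} (hx : x ≠ 0) (h0 : IsFormalAtZero Θ₀ x A₁ A₂ G₀)
    (hI : IsFormalAtInfinity ΘI x A₁ A₂ GI) (hq : A₂ 0 1 ≠ 0)
    (hy : y = -I * (A₁ 0 1 / A₂ 0 1)) :
    x * (jmuZero G₀ + jmuInfinity GI) = jmuHamiltonian Θ₀ ΘI x y (A₂ 0 0) := by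
  obtain ⟨-, r2, -, -, r5, r6⟩ := formal_relations hx h0 hI
  have hb : A₁ 0 1 = I * y * A₂ 0 1 := by
    rw [hy]; field_simp; rw [I_sq]; ring
  rw [r6, jmuHamiltonian]
  rw [hb] at r5 ⊢
  linear_combination (2 * I * y) * r5 + (-2 * I ^ 2 * y ^ 2) * r2 +
    2 * y ^ 2 * ((x : ℂ) ^ 2 / 4 + A₂ 0 0 ^ 2) * I_sq

variable {n : ℕ} {ν : ℂ}

theorem isLaxPair_ratioA {U : Set ℝ} (hU : U ⊆ regularSet n ν) :
    IsLaxPair (ratioA n ν) U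
      (fun x => laxOne (ν - n) (-(n + ν)) x (ratioA n ν x) (auxS n ν x))
      (fun x => laxTwo x (auxS n ν x))
      (fun x => deformationZero (ν - n) (-(n + ν)) x (ratioA n ν x) (auxS n ν x))
      (fun x => deformationOne x (auxS n ν x)) := by
  refine isLaxPair_of_system (fun x hx => (hU hx).1.ne') (fun x hx => ?_) fun x hx => ?_
  · refine (hasDerivAt_ratioA (hU hx)).congr_deriv ?_
    ring
  · refine (hasDerivAt_auxS (hU hx)).congr_deriv ?_
    ring

/-- The product of the Toeplitz determinant and the Gaussian factor, the τ-function of `a_n`. -/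
noncomputable def toeplitzTau (n : ℕ) (ν : ℂ) (x : ℝ) : ℂ :=
  toeplitzDet n ν (2 * x) * Complex.exp (-(x : ℂ) ^ 2 / 2)

theorem toeplitzDet_eq_toeplitzTau (t : ℝ) :
    toeplitzDet n ν t = Complex.exp ((t : ℂ) ^ 2 / 8) * toeplitzTau n ν (t / 2) := by
  rw [toeplitzTau, mul_div_cancel₀ _ (two_ne_zero), mul_left_comm, ← Complex.exp_add]
  have h : (t : ℂ) ^ 2 / 8 + -((t / 2 : ℝ) : ℂ) ^ 2 / 2 = 0 := by push_cast; ring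
  rw [h, Complex.exp_zero, mul_one]

theorem analyticAt_toeplitzTau {x : ℝ} (hx : 0 < x) : AnalyticAt ℝ (toeplitzTau n ν) x := by
  have h1 : AnalyticAt ℝ (fun x : ℝ => (x : ℂ)) x := Complex.ofRealCLM.analyticAt x
  have h2 : AnalyticAt ℝ (fun x : ℝ => -(x : ℂ) ^ 2 / 2) x :=
    (h1.pow 2).neg.div analyticAt_const two_ne_zero
  exact (analyticAt_toeplitzDet n hx).mul
    ((analyticAt_cexp.restrictScalars (𝕜 := ℝ)).comp h2)

/-- The Gaussian factor contributes `-x`, which is precisely the difference between `D_n'/D_n` and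
the residue sum. -/
theorem hasDerivAt_toeplitzTau {x : ℝ} (hx : x ∈ regularSet n ν) :
    HasDerivAt (toeplitzTau n ν) (jmuHamiltonian (ν - n) (-(n + ν)) x (ratioA n ν x)
      (laxDiag x (auxS n ν x)) / x * toeplitzTau n ν x) x := by
  have hx' : (x : ℂ) ≠ 0 := by exact_mod_cast hx.1.ne'
  have h1 : HasDerivAt (fun x : ℝ => -(x : ℂ) ^ 2 / 2) (-x : ℂ) x := by
    refine (((hasDerivAt_id x).ofReal_comp.pow 2).neg.div_const 2).congr_deriv ?_
    simp
    ring
  refine ((hasDerivAt_toeplitzDet hx).mul h1.cexp).congr_deriv ?_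
  rw [toeplitzTau, jmuHamiltonian, laxDiag]
  generalize Complex.exp (-(x : ℂ) ^ 2 / 2) = E
  generalize toeplitzDet n ν (2 * x) = D
  generalize ratioA n ν x = y
  generalize auxS n ν x = s
  field_simp
  ring_nf
  simp only [I_sq]
  ring

theorem isJMUTau_toeplitzTau {U : Set ℝ} (hU : U ⊆ regularSet n ν) :
    IsJMUTau (ν - n) (-(n + ν)) (ratioA n ν) U (toeplitzTau n ν) := by
  refine ⟨_, _, _, _, isLaxPair_ratioA hU, fun x hx => ⟨?_, ?_⟩⟩
  · exact mul_ne_zero (hU hx).2.1 (Complex.exp_ne_zero _)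
  · have hx0 : x ≠ 0 := (hU hx).1.ne'
    obtain ⟨G₀, GI, h0, hI⟩ := exists_formal_lax hx0 (ν - n) (-(n + ν)) (ratioA n ν x)
      (auxS n ν x)
    refine ⟨G₀, GI, h0, hI, (hasDerivAt_toeplitzTau (hU hx)).congr_deriv ?_⟩
    obtain ⟨hq, hy⟩ := (isLaxPair_ratioA hU).2 x hx
    congr 1
    rw [div_eq_iff (by exact_mod_cast hx0), mul_comm]
    exact (mul_jmu_eq hx0 h0 hI hq hy).symm

/-- The diagonal entry of the leading coefficient at `λ = 0` is determined by the solution. -/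
theorem lax_diagonal_eq {U : Set ℝ} (hUo : IsOpen U) (hU : U ⊆ regularSet n ν)
    {A₁ A₂ B₀ B₁ : ℝ → Matrix (Fin 2) (Fin 2) ℂ} (h : IsLaxPair (ratioA n ν) U A₁ A₂ B₀ B₁)
    (hG : ∀ x ∈ U, ∃ G₀ GI : Matrix (Fin 2) (Fin 2) ℂ⟦X⟧,
      IsFormalAtZero (ν - n) x (A₁ x) (A₂ x) G₀ ∧
      IsFormalAtInfinity (-(n + ν)) x (A₁ x) (A₂ x) GI) {x : ℝ} (hx : x ∈ U) :
    A₂ x 0 0 = laxDiag x (auxS n ν x) := by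
  have hlax := fun x (hx : x ∈ U) => h.hasDerivAt hUo (fun x hx => (hU hx).1.ne') hG hx
  have hne : ∀ x ∈ U, ratioA n ν x ≠ 0 → A₂ x 0 0 = laxDiag x (auxS n ν x) := by
    intro x hx hy
    have hx' : (x : ℂ) ≠ 0 := by exact_mod_cast (hU hx).1.ne'
    have h1 := (hlax x hx).1.unique (hasDerivAt_ratioA (hU hx))
    refine mul_left_cancel₀ (mul_ne_zero I_ne_zero (pow_ne_zero 2 hy)) ?_
    rw [laxDiag]
    generalize A₂ x 0 0 = p at *
    field_simp at h1
    linear_combination h1 / 4 + ratioA n ν x ^ 2 * (x : ℂ) / 2 * (1 - 2 * auxS n ν x) * I_sq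
  -- At a zero of `a_n` the Riccati comparison loses `p`. There the derivative is `2`, so the zero
  -- is isolated and continuity of both sides extends the identity.
  by_cases hy : ratioA n ν x = 0
  · have hd := hasDerivAt_ratioA (hU hx)
    have hev : ∀ᶠ z in 𝓝[≠] x, A₂ z 0 0 = laxDiag z (auxS n ν z) := by
      filter_upwards [hd.eventually_ne (c := 0) (by rw [hy]; simp),
        nhdsWithin_le_nhds (hUo.mem_nhds hx)] with z hz hzU using hne z hzU hz
    have hc : ContinuousAt (fun z => laxDiag z (auxS n ν z)) x := by
      have := (hasDerivAt_auxS (hU hx)).continuousAt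
      unfold laxDiag
      have h2 : ContinuousAt (fun z : ℝ => (z : ℂ)) x := Complex.continuous_ofReal.continuousAt
      fun_prop
    exact tendsto_nhds_unique_of_eventuallyEq
      ((hlax x hx).2.tendsto.mono_left nhdsWithin_le_nhds)
      (hc.tendsto.mono_left nhdsWithin_le_nhds) hev
  · exact hne x hx hy

theorem IsJMUTau.hasDerivAt {U : Set ℝ} (hUo : IsOpen U) (hU : U ⊆ regularSet n ν) {τ : ℝ → ℂ}
    (h : IsJMUTau (ν - n) (-(n + ν)) (ratioA n ν) U τ) {x : ℝ} (hx : x ∈ U) :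
    HasDerivAt τ (jmuHamiltonian (ν - n) (-(n + ν)) x (ratioA n ν x)
      (laxDiag x (auxS n ν x)) / x * τ x) x := by
  obtain ⟨A₁, A₂, B₀, B₁, hL, hτ⟩ := h
  have hG : ∀ x ∈ U, ∃ G₀ GI : Matrix (Fin 2) (Fin 2) ℂ⟦X⟧,
      IsFormalAtZero (ν - n) x (A₁ x) (A₂ x) G₀ ∧
      IsFormalAtInfinity (-(n + ν)) x (A₁ x) (A₂ x) GI := fun x hx => by
    obtain ⟨-, G₀, GI, h0, hI, -⟩ := hτ x hx
    exact ⟨G₀, GI, h0, hI⟩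
  have hp := lax_diagonal_eq hUo hU hL hG hx
  obtain ⟨-, G₀, GI, h0, hI, hd⟩ := hτ x hx
  have hx0 : x ≠ 0 := (hU hx).1.ne'
  have hx' : (x : ℂ) ≠ 0 := by exact_mod_cast hx0
  obtain ⟨hq, hy⟩ := hL.2 x hx
  rwa [← hp, ← mul_jmu_eq hx0 h0 hI hq hy, mul_div_cancel_left₀ _ hx']

/-- Both functions solve the same linear first-order equation, so their quotient has zero derivative
on a connected set. -/
theorem IsJMUTau.exists_eq_mul {U : Set ℝ} (hUo : IsOpen U) (hUc : IsPreconnected U)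
    (hU : U ⊆ regularSet n ν) {τ : ℝ → ℂ}
    (h : IsJMUTau (ν - n) (-(n + ν)) (ratioA n ν) U τ) :
    ∃ c : ℂ, c ≠ 0 ∧ ∀ x ∈ U, toeplitzTau n ν x = c * τ x := by
  rcases U.eq_empty_or_nonempty with rfl | ⟨x₀, hx₀⟩
  · exact ⟨1, one_ne_zero, fun x hx => hx.elim⟩
  have hτ0 : ∀ x ∈ U, τ x ≠ 0 := by
    obtain ⟨A₁, A₂, B₀, B₁, -, hτ⟩ := h
    exact fun x hx => (hτ x hx).1
  have hd : ∀ x ∈ U, HasDerivAt (fun x => toeplitzTau n ν x / τ x) 0 x := by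
    intro x hx
    refine ((hasDerivAt_toeplitzTau (hU hx)).div (h.hasDerivAt hUo hU hx)
      (hτ0 x hx)).congr_deriv ?_
    rw [div_eq_zero_iff]
    left; ring
  refine ⟨toeplitzTau n ν x₀ / τ x₀, div_ne_zero ?_ (hτ0 x₀ hx₀), fun x hx => ?_⟩
  · exact mul_ne_zero (hU hx₀).2.1 (Complex.exp_ne_zero _)
  · have hc := hUo.is_const_of_deriv_eq_zero hUc
      (fun x hx => (hd x hx).differentiableAt.differentiableWithinAt)
      (fun x hx => (hd x hx).deriv) hx hx₀
    rw [← div_eq_iff (hτ0 x hx)]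
    exact hc

end TauFunction

theorem theorem1p1 (n : ℕ) (ν : ℂ) :
    (∀ x ∈ regularSet n ν, (monicOP (n + 1) ν (2 * x)).eval 0 ≠ 0 →
      AnalyticAt ℝ (ratioA n ν) x ∧
      deriv (deriv (ratioA n ν)) x =
        (deriv (ratioA n ν) x) ^ 2 / ratioA n ν x - deriv (ratioA n ν) x / (x : ℂ)
          + 4 / (x : ℂ) * ((ν - n) * ratioA n ν x ^ 2 + n + ν + 1)
          + 4 * ratioA n ν x ^ 3 - 4 / ratioA n ν x) ∧
    (∃ (τ : ℝ → ℂ) (c : ℂ), c ≠ 0 ∧ AnalyticOnNhd ℝ τ (Set.Ioi 0) ∧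
      IsJMUTau (ν - n) (-(n + ν)) (ratioA n ν) (regularSet n ν) τ ∧
      ∀ t : ℝ, 0 < t → toeplitzDet n ν t = c * Complex.exp ((t : ℂ) ^ 2 / 8) * τ (t / 2)) ∧
    (∀ J : Set ℝ, IsOpen J → IsPreconnected J → J ⊆ regularSet n ν → ∀ τ : ℝ → ℂ,
      IsJMUTau (ν - n) (-(n + ν)) (ratioA n ν) J τ →
      ∃ c : ℂ, c ≠ 0 ∧ ∀ t : ℝ, t / 2 ∈ J →
        toeplitzDet n ν t = c * Complex.exp ((t : ℂ) ^ 2 / 8) * τ (t / 2)) := by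
  refine ⟨fun x hx hπ => ⟨analyticAt_ratioA hx, painleve_ratioA hx ?_⟩,
    ⟨toeplitzTau n ν, 1, one_ne_zero, fun x hx => analyticAt_toeplitzTau hx,
      isJMUTau_toeplitzTau subset_rfl, fun t _ => ?_⟩, fun J hJ hJc hJR τ hτ => ?_⟩
  · exact neg_ne_zero.2 (div_ne_zero hπ hx.2.2.2)
  · rw [one_mul, ← toeplitzDet_eq_toeplitzTau]
  · obtain ⟨c, hc, h⟩ := hτ.exists_eq_mul hJ hJc hJR
    refine ⟨c, hc, fun t ht => ?_⟩
    rw [toeplitzDet_eq_toeplitzTau, h _ ht]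
    ring
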